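/- Setting. Let $\mathcal G$ be a weighted directed graph on $\{1,\dots,N\}$ with nonnegative weights $a_{ij}$ (there is an edge from $j$ to $i$ iff $a_{ij}>0$) that is strongly connected and weight-balanced ($\sum_j a_{ij}=\sum_j a_{ji}=:d_i$ for all $i$), let $L=\mathrm{diag}(d_1,\dots,d_N)-(a_{ij})$ be its Laplacian and $\boldsymbol L=L\otimes I_p$. For each $i$ let $\Omega_i\subseteq\mathbb R^{n_i}$ be closed and convex, let $f_i:\Omega_i\to\mathbb R$ be differentiable with $(x-y)^T(\nabla f_i(x)-\nabla f_i(y))\ge\mu_f\|x-y\|^2$ and $\|\nabla f_i(x)-\nabla f_i(y)\|\le\kappa_f\|x-y\|$ on $\Omega_i$, and let $g_i:\Omega_i\to\mathbb R^p$ be (componentwise) convex, differentiable and $\kappa_g$-Lipschitz on $\Omega_i$ with $\nabla g_i$ locally Lipschitz on $\Omega_i$, where $\mu_f,\kappa_f,\kappa_g>0$ and $\nabla g_i$ denotes the transposed Jacobian. For $\boldsymbol x=(x_1,\dots,x_N)\in\boldsymbol\Omega=\Omega_1\times\cdots\times\Omega_N$ and $\boldsymbol\lambda=(\lambda_1,\dots,\lambda_N)\in(\mathbb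 R^p)^N$ put $f(\boldsymbol x)=\sum_i f_i(x_i)$, $g(\boldsymbol x)=\sum_i g_i(x_i)$, $\boldsymbol u(\boldsymbol x)=(g_1(x_1),\dots,g_N(x_N))$, $\boldsymbol v(\boldsymbol x,\boldsymbol\lambda)=(\nabla g_1(x_1)\lambda_1,\dots,\nabla g_N(x_N)\lambda_N)$. Assume that some $\tilde{\boldsymbol x}$ in the relative interior of $\boldsymbol\Omega$ satisfies $g(\tilde{\boldsymbol x})<\boldsymbol 0$. All norms are Euclidean and $P_C$ is the Euclidean projection onto $C$. For $\varepsilon>0$, an equilibrium is a pair $(\boldsymbol x,\boldsymbol\lambda)$ with $$\boldsymbol 0=P_{\boldsymbol\Omega}\big(\boldsymbol x-\nabla f(\boldsymbol x)-\boldsymbol v(\boldsymbol x,\boldsymbol\lambda)\big)-\boldsymbol x,\qquad \boldsymbol 0=P_{\mathbb R_+^{pN}}\big(\varepsilon\boldsymbol\lambda+\varepsilon\boldsymbol u(\boldsymbol x)-\boldsymbol L\boldsymbol\lambda\big)-\varepsilon\boldsymbol\lambda .$$ Let $U=\{u\in\mathbb R^N:\boldsymbol 1^Tu\le 0\}$,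 and for $u\in U$ let $\mathrm{SOL}(-u,L)$ be the solution set of the linear complementarity problem $0\le z\perp Lz-u\ge 0$. Call $\kappa_L>0$ an LCP constant of $L$ if the set-valued map $u\mapsto\mathrm{SOL}(-u,L)$ has a single-valued selection on $U$ that is $\kappa_L$-Lipschitz on $U$. Theorem. An LCP constant $\kappa_L$ of $L$ exists, and the problem $\min_{\boldsymbol x\in\boldsymbol\Omega}f(\boldsymbol x)$ subject to $g(\boldsymbol x)\le\boldsymbol 0$ has a unique optimal solution $\boldsymbol x^*$. Let $\kappa_L$ be any LCP constant of $L$, and put $$\varepsilon^*=\frac{\mu_f}{\kappa_g^2\kappa_L},\qquad K=\frac{2\kappa_g\kappa_L\|\boldsymbol u(\boldsymbol x^*)\|}{\mu_f}.$$ Then for every $\varepsilon\in(0,\varepsilon^*/2)$ an equilibrium exists, and every equilibrium $(\boldsymbol x^*_\varepsilon,\boldsymbol\lambda^*_\varepsilon)$ satisfies $$\|\boldsymbol x^*_\varepsilon-\boldsymbol x^*\|\le K\varepsilon .$$ -/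

import Mathlib

open scoped Matrix

noncomputable section

namespace ResourceAllocation

/-! ### Projections, variational inequalities, linear complementarity problems -/

/-- `y = P_C(x)`: the point `y` of `C` minimizes the Euclidean distance to `x` over `C`. -/
def IsProj {E : Type*} [NormedAddCommGroup E] (C : Set E) (x y : E) : Prop :=
  y ∈ C ∧ ∀ z ∈ C, ‖x - y‖ ≤ ‖x - z‖

/-- The solution set of the variational inequality `VI(Ω, F)`. -/
def viSol {E : Type*} [NormedAddCommGroup E] [InnerProductSpace ℝ E]
    (Ω : Set E) (F : E → E) : Set E :=
  {x | x ∈ Ω ∧ ∀ y ∈ Ω, 0 ≤ inner ℝ (y - x) (F x)}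

/-- The nonnegative orthant. -/
def orthant (N : ℕ) : Set (EuclideanSpace ℝ (Fin N)) :=
  {z | ∀ i, 0 ≤ z i}

/-- The solution set of `LCP(q, M)`, i.e. of the variational inequality for `z ↦ q + M z` over the
nonnegative orthant. -/
def lcpSol {N : ℕ} (q : EuclideanSpace ℝ (Fin N)) (M : Matrix (Fin N) (Fin N) ℝ) :
    Set (EuclideanSpace ℝ (Fin N)) :=
  viSol (orthant N) (fun z => q + WithLp.toLp 2 (M *ᵥ WithLp.ofLp z))

/-! ### Weighted directed graphs -/

/-- A weighted directed graph on `{1, …, N}`, given by its nonnegative weight matrix. -/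
structure WeightedDigraph (N : ℕ) where
  weight : Matrix (Fin N) (Fin N) ℝ
  weight_nonneg : ∀ i j, 0 ≤ weight i j

namespace WeightedDigraph

variable {N : ℕ} (G : WeightedDigraph N)

/-- `(j, i)` is an edge (`j` sends information to `i`) iff `a i j > 0`. -/
def Edge (j i : Fin N) : Prop := 0 < G.weight i j

/-- There is a directed path from every vertex to every vertex. -/
def StronglyConnected : Prop := ∀ j i, Relation.ReflTransGen G.Edge j i

def WeightBalanced : Prop := ∀ i, ∑ j, G.weight i j = ∑ j, G.weight j i

/-- `L = D - A` with `D = diag(d₁, …, d_N)`, `d i = ∑ j, a i j`. -/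
def laplacian : Matrix (Fin N) (Fin N) ℝ :=
  Matrix.diagonal (fun i => ∑ j, G.weight i j) - G.weight

end WeightedDigraph

/-- `U = {u | 𝟏ᵀ u ≤ 0}`. -/
def lcpDomain (N : ℕ) : Set (EuclideanSpace ℝ (Fin N)) :=
  {u | ∑ i, u i ≤ 0}

/-- `κ` is an LCP constant of the matrix `L`: the solution map `u ↦ SOL(-u, L)` has a
(single-valued) selection on `U = {u | 𝟏ᵀ u ≤ 0}` that is `κ`-Lipschitz on `U`. -/
def IsLCPConstant {N : ℕ} (L : Matrix (Fin N) (Fin N) ℝ) (κ : ℝ) : Prop :=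
  ∃ S : EuclideanSpace ℝ (Fin N) → EuclideanSpace ℝ (Fin N),
    (∀ u ∈ lcpDomain N, S u ∈ lcpSol (-u) L) ∧
    ∀ u ∈ lcpDomain N, ∀ u' ∈ lcpDomain N, ‖S u' - S u‖ ≤ κ * ‖u' - u‖

/-! ### The resource allocation problem -/

/-- Data of the problem `min ∑ f i (x i)` s.t. `x i ∈ Ω i`, `∑ g i (x i) ≤ 0`, with differentiable
`f i : Ω i → ℝ` and `g i : Ω i → ℝᵖ`. Values outside `Ω i` are irrelevant. `gradf i` and `jacg i`
are the gradient of `f i` and the derivative of `g i` over `Ω i`. (They are carried along since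
`Ω i` may have empty interior, in which case differentiability over `Ω i` determines them only in
directions parallel to `Ω i`.) -/
structure Problem (N p : ℕ) where
  n : Fin N → ℕ
  Ω : ∀ i, Set (EuclideanSpace ℝ (Fin (n i)))
  f : ∀ i, EuclideanSpace ℝ (Fin (n i)) → ℝ
  gradf : ∀ i, EuclideanSpace ℝ (Fin (n i)) → EuclideanSpace ℝ (Fin (n i))
  g : ∀ i, EuclideanSpace ℝ (Fin (n i)) → EuclideanSpace ℝ (Fin p)
  jacg : ∀ i, EuclideanSpace ℝ (Fin (n i)) →
    (EuclideanSpace ℝ (Fin (n i)) →L[ℝ] EuclideanSpace ℝ (Fin p))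
  hasGradient_f : ∀ i, ∀ x ∈ Ω i, HasGradientWithinAt (f i) (gradf i x) (Ω i) x
  hasDeriv_g : ∀ i, ∀ x ∈ Ω i, HasFDerivWithinAt (g i) (jacg i x) (Ω i) x

/-- Stacked multipliers `λ = col(λ₁, …, λ_N)`, with the Euclidean norm of `ℝ^{pN}`. -/
abbrev Dual (N p : ℕ) : Type := PiLp 2 (fun _ : Fin N => EuclideanSpace ℝ (Fin p))

/-- The nonnegative orthant of `ℝ^{pN}`. -/
def dualOrthant (N p : ℕ) : Set (Dual N p) := {lam | ∀ i k, 0 ≤ lam i k}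

/-- The action of `L ⊗ I_p` on stacked vectors: the `i`-th block is `∑ j, L i j • λ j`. -/
def blockMul {N p : ℕ} (L : Matrix (Fin N) (Fin N) ℝ) (lam : Dual N p) : Dual N p :=
  WithLp.toLp 2 (fun i => ∑ j, L i j • lam j)

namespace Problem

variable {N p : ℕ} (P : Problem N p)

/-- Stacked decisions `x = col(x₁, …, x_N)`, with the Euclidean norm. -/
abbrev Primal : Type := PiLp 2 (fun i : Fin N => EuclideanSpace ℝ (Fin (P.n i)))

/-- `Ω = Ω₁ × ⋯ × Ω_N`. -/
def prodΩ : Set P.Primal := {x | ∀ i, x i ∈ P.Ω i}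

/-- `f(x) = ∑ f i (x i)`. -/
def totalCost (x : P.Primal) : ℝ := ∑ i, P.f i (x i)

/-- `g(x) = ∑ g i (x i)`. -/
def totalResource (x : P.Primal) : EuclideanSpace ℝ (Fin p) := ∑ i, P.g i (x i)

/-- The feasible set `{x ∈ Ω | g(x) ≤ 0}`. -/
def feasible : Set P.Primal := {x | x ∈ P.prodΩ ∧ ∀ k, P.totalResource x k ≤ 0}

/-- `x` is an optimal solution of `min_{x ∈ Ω} f(x)` s.t. `g(x) ≤ 0`. -/
def IsOptimal (x : P.Primal) : Prop :=
  x ∈ P.feasible ∧ ∀ y ∈ P.feasible, P.totalCost x ≤ P.totalCost y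

/-- `∇f(x) = col(∇f₁(x₁), …, ∇f_N(x_N))`. -/
def gradCost (x : P.Primal) : P.Primal := WithLp.toLp 2 (fun i => P.gradf i (x i))

/-- `u(x) = col(g₁(x₁), …, g_N(x_N))`. -/
def u (x : P.Primal) : Dual N p := WithLp.toLp 2 (fun i => P.g i (x i))

/-- `v(x, λ) = col(∇g₁(x₁) λ₁, …, ∇g_N(x_N) λ_N)`, where `∇g i` is the transposed Jacobian. -/
def v (x : P.Primal) (lam : Dual N p) : P.Primal :=
  WithLp.toLp 2 (fun i => ContinuousLinearMap.adjoint (P.jacg i (x i)) (lam i))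

/-- `(x, λ)` is an equilibrium:
`0 = P_Ω(x - ∇f(x) - v(x, λ)) - x` and `0 = P_{ℝ₊^{pN}}(ε λ + ε u(x) - (L ⊗ I_p) λ) - ε λ`. -/
def IsEquilibrium (L : Matrix (Fin N) (Fin N) ℝ) (ε : ℝ) (x : P.Primal) (lam : Dual N p) : Prop :=
  IsProj P.prodΩ (x - P.gradCost x - P.v x lam) x ∧
  IsProj (dualOrthant N p) (ε • lam + ε • P.u x - blockMul L lam) (ε • lam)

/-- The standing assumptions on costs, local sets and resource maps. -/
structure Assumptions (μf κf κg : ℝ) : Prop where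
  μf_pos : 0 < μf
  κf_pos : 0 < κf
  κg_pos : 0 < κg
  strongConvex_f : ∀ i, ∀ x ∈ P.Ω i, ∀ y ∈ P.Ω i,
    μf * ‖x - y‖ ^ 2 ≤ inner ℝ (x - y) (P.gradf i x - P.gradf i y)
  lipschitz_gradf : ∀ i, ∀ x ∈ P.Ω i, ∀ y ∈ P.Ω i,
    ‖P.gradf i x - P.gradf i y‖ ≤ κf * ‖x - y‖
  closed_Ω : ∀ i, IsClosed (P.Ω i)
  convex_Ω : ∀ i, Convex ℝ (P.Ω i)
  convex_g : ∀ i k, ConvexOn ℝ (P.Ω i) (fun x => P.g i x k)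
  lipschitz_g : ∀ i, ∀ x ∈ P.Ω i, ∀ y ∈ P.Ω i, ‖P.g i x - P.g i y‖ ≤ κg * ‖x - y‖
  locallyLipschitz_jacg : ∀ i, LocallyLipschitzOn (P.Ω i) (P.jacg i)
  slater : ∃ x ∈ intrinsicInterior ℝ P.prodΩ, ∀ k, P.totalResource x k < 0

end Problem

end ResourceAllocation

end

noncomputable section

namespace ResourceAllocation

/-! ### Projections and strongly monotone variational inequalities -/

section VariationalInequality

variable {E : Type*} [NormedAddCommGroup E] [InnerProductSpace ℝ E]

/-! Unwinding the projections, (x, λ) is an equilibrium exactly when x solves the variational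
inequality over Ω for ∇f + v(·, λ) and every column of λ solves the LCP whose data are that column
of ε u(x). Since 𝟏ᵀL = 0, the LCPs force g(x) ≤ 0. Two monotonicity facts drive the proof: the
tangent inequality for the convex function ⟨λ, u(·)⟩ with λ ≥ 0 (`inner_sub_v_le`), and monotonicity
of the LCP solution relation, which comes from positive semidefiniteness of a balanced L
(`IsBlockLCPSol.inner_sub_nonneg`).

Error bound: let s be the Lipschitz selection applied to the columns of ε u(x*). Test the
variational inequality of x* at x and that of x at x*. Strong monotonicity and the two facts give μf
‖x - x*‖² ≤ ⟨s, u(x*) - u(x)⟩, from which λ has disappeared. Since ‖s‖ ≤ κL ε ‖u(x*)‖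
(`norm_lcp_selection_le`), Cauchy–Schwarz yields the estimate, even with K/2.

Existence: with the selection substituted for λ, the map becomes strongly monotone and Lipschitz on
compact subsets of the feasible set, so the reduced variational inequality is solvable
(`exists_mem_viSol_reduced`). Slater's condition gives Lagrange multipliers c for g ≤ 0 at its
solution. Adding c to every block of λ passes from the feasible set to Ω, and the LCPs stay solved
because L kills constants and c is complementary to g(x).

LCP constant: a solution of least coordinate sum has a zero coordinate. For two such solutions, the
mean of the difference is therefore controlled by its mean-free part, on which L is coercive. -/

theorem isProj_iff_inner_le_zero {C : Set E} (hC : Convex ℝ C) {x y : E} :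
    IsProj C x y ↔ y ∈ C ∧ ∀ z ∈ C, inner ℝ (x - y) (z - y) ≤ 0 := by
  refine and_congr_right fun hy => ?_
  rw [← norm_eq_iInf_iff_real_inner_le_zero hC hy]
  have hbdd : BddBelow (Set.range fun w : C => ‖x - w‖) :=
    ⟨0, by rintro _ ⟨w, rfl⟩; exact norm_nonneg _⟩
  have : Nonempty C := ⟨⟨y, hy⟩⟩
  constructor
  · intro h
    exact le_antisymm (le_ciInf fun w => h w w.2) (ciInf_le hbdd ⟨y, hy⟩)
  · intro h z hz
    rw [h]
    exact ciInf_le hbdd ⟨z, hz⟩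

theorem isProj_sub_iff_mem_viSol {C : Set E} (hC : Convex ℝ C) (F : E → E) (x : E) :
    IsProj C (x - F x) x ↔ x ∈ viSol C F := by
  rw [isProj_iff_inner_le_zero hC]
  refine and_congr_right fun _ => forall₂_congr fun z _ => ?_
  rw [sub_sub_cancel_left, inner_neg_left, neg_nonpos, real_inner_comm]

/-- Add the two variational characterizations, each tested at the other projection, and apply
Cauchy–Schwarz. -/
theorem norm_sub_le_of_isProj {C : Set E} (hC : Convex ℝ C) {x x' y y' : E}
    (h : IsProj C x y) (h' : IsProj C x' y') : ‖y - y'‖ ≤ ‖x - x'‖ := by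
  rw [isProj_iff_inner_le_zero hC] at h h'
  have h1 := h.2 y' h'.1
  have h2 := h'.2 y h.1
  have h3 : ‖y - y'‖ ^ 2 ≤ inner ℝ (x - x') (y - y') := by
    rw [← real_inner_self_eq_norm_sq]
    simp only [inner_sub_left, inner_sub_right] at h1 h2 ⊢
    linarith [real_inner_comm y y']
  have h4 := real_inner_le_norm (x - x') (y - y')
  by_contra hlt
  push Not at hlt
  nlinarith [norm_nonneg (x - x'), norm_nonneg (y - y')]

/-- A solution is a fixed point of x ↦ P_K(x - τ F x), which is a contraction for a suitable step τ.
-/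
theorem exists_mem_viSol_of_lipschitz [CompleteSpace E] {K : Set E} (hne : K.Nonempty)
    (hcl : IsClosed K) (hconv : Convex ℝ K) {F : E → E} {μ l : ℝ} (hμ : 0 < μ)
    (hmono : ∀ x ∈ K, ∀ y ∈ K, μ * ‖x - y‖ ^ 2 ≤ inner ℝ (x - y) (F x - F y))
    (hlip : ∀ x ∈ K, ∀ y ∈ K, ‖F x - F y‖ ≤ l * ‖x - y‖) : ∃ x, x ∈ viSol K F := by
  obtain ⟨m, hμm, hlm⟩ : ∃ m, μ ≤ m ∧ l ≤ m := ⟨max μ l, le_max_left _ _, le_max_right _ _⟩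
  have hm : 0 < m := hμ.trans_le hμm
  -- This τ minimizes 1 - 2τμ + τ²m², with minimum 1 - τμ; enlarging the Lipschitz constant to m ≥ μ
  -- keeps that nonnegative.
  set τ : ℝ := μ / m ^ 2 with hτ
  have hτpos : 0 < τ := by positivity
  have hproj : ∀ x, ∃ y, IsProj K x y := fun x => by
    obtain ⟨y, hy, h⟩ := exists_norm_eq_iInf_of_complete_convex hne hcl.isComplete hconv x
    refine ⟨y, hy, fun z hz => h ▸ ciInf_le ⟨0, ?_⟩ (⟨z, hz⟩ : K)⟩
    rintro _ ⟨w, rfl⟩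
    exact norm_nonneg _
  choose π hπ using hproj
  have hq : 0 ≤ 1 - τ * μ := by
    have : τ * μ = (μ / m) ^ 2 := by rw [hτ]; field_simp
    have h1 : μ / m ≤ 1 := (div_le_one hm).2 hμm
    have h0 : 0 ≤ μ / m := by positivity
    rw [this]; nlinarith
  have hstep : ∀ x ∈ K, ∀ y ∈ K,
      ‖π (x - τ • F x) - π (y - τ • F y)‖ ≤ √(1 - τ * μ) * ‖x - y‖ := by
    intro x hx y hy
    refine (norm_sub_le_of_isProj hconv (hπ _) (hπ _)).trans ?_
    refine le_of_sq_le_sq ?_ (by positivity)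
    have e : x - τ • F x - (y - τ • F y) = (x - y) - τ • (F x - F y) := by
      rw [smul_sub]; abel
    rw [e, norm_sub_sq_real, mul_pow, Real.sq_sqrt hq, inner_smul_right, norm_smul,
      Real.norm_of_nonneg hτpos.le]
    have h1 := hmono x hx y hy
    have h2 : ‖F x - F y‖ ≤ m * ‖x - y‖ :=
      (hlip x hx y hy).trans (mul_le_mul_of_nonneg_right hlm (norm_nonneg _))
    have h3 : (τ * ‖F x - F y‖) ^ 2 ≤ (τ * (m * ‖x - y‖)) ^ 2 := by gcongr
    have h4 : (τ * (m * ‖x - y‖)) ^ 2 = τ * μ * ‖x - y‖ ^ 2 := by rw [hτ]; field_simp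
    have h5 := mul_le_mul_of_nonneg_left h1 hτpos.le
    nlinarith
  have hmaps : Set.MapsTo (fun x => π (x - τ • F x)) K K := fun x _ => (hπ _).1
  have hcontr : ContractingWith (Real.toNNReal √(1 - τ * μ)) (hmaps.restrict _ K K) := by
    constructor
    · rw [Real.toNNReal_lt_one, Real.sqrt_lt' one_pos]
      nlinarith [mul_pos hτpos hμ]
    · refine LipschitzWith.of_dist_le_mul fun x y => ?_
      rw [Real.coe_toNNReal _ (Real.sqrt_nonneg _), Subtype.dist_eq, Subtype.dist_eq,
        dist_eq_norm, dist_eq_norm]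
      exact hstep x x.2 y y.2
  obtain ⟨x₀, hx₀⟩ := hne
  obtain ⟨x, hx, hfix, -⟩ := hcontr.exists_fixedPoint' hcl.isComplete hmaps hx₀ (edist_ne_top _ _)
  have h := hπ (x - τ • F x)
  rw [show π (x - τ • F x) = x from hfix, isProj_sub_iff_mem_viSol hconv (fun x => τ • F x)] at h
  refine ⟨x, hx, fun y hy => ?_⟩
  have := h.2 y hy
  rw [inner_smul_right] at this
  exact nonneg_of_mul_nonneg_right this hτpos

/-- A variational inequality with a strongly monotone map that is Lipschitz on compact sets is
solvable over every nonempty closed convex set. -/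
theorem exists_mem_viSol [FiniteDimensional ℝ E] {K : Set E} (hne : K.Nonempty)
    (hcl : IsClosed K) (hconv : Convex ℝ K) {F : E → E} {μ : ℝ} (hμ : 0 < μ)
    (hmono : ∀ x ∈ K, ∀ y ∈ K, μ * ‖x - y‖ ^ 2 ≤ inner ℝ (x - y) (F x - F y))
    (hlip : ∀ C ⊆ K, IsCompact C →
      ∃ l : ℝ, ∀ x ∈ C, ∀ y ∈ C, ‖F x - F y‖ ≤ l * ‖x - y‖) : ∃ x, x ∈ viSol K F := by
  have := FiniteDimensional.complete ℝ E
  have := FiniteDimensional.proper_real E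
  obtain ⟨x₀, hx₀⟩ := hne
  -- Testing against x₀ puts any solution over K ∩ closedBall x₀ R within ‖F x₀‖ / μ of x₀, so the
  -- ball constraint is inactive and can be removed.
  set R : ℝ := ‖F x₀‖ / μ + 1 with hR
  have hRpos : 0 < R := by positivity
  set C := K ∩ Metric.closedBall x₀ R with hC
  have hCK : C ⊆ K := Set.inter_subset_left
  have hx₀C : x₀ ∈ C := ⟨hx₀, Metric.mem_closedBall_self hRpos.le⟩
  obtain ⟨l, hl⟩ := hlip C hCK ((isCompact_closedBall x₀ R).inter_left hcl)
  obtain ⟨x, hxC, hx⟩ := exists_mem_viSol_of_lipschitz ⟨x₀, hx₀C⟩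
    (hcl.inter Metric.isClosed_closedBall) (hconv.inter (convex_closedBall x₀ R)) hμ
    (fun x hx y hy => hmono x (hCK hx) y (hCK hy)) hl
  have hdist : ‖x - x₀‖ < R := by
    have h1 := hmono x hxC.1 x₀ hx₀
    have h2 := hx x₀ hx₀C
    have h3 := real_inner_le_norm (x₀ - x) (F x₀)
    rw [norm_sub_rev] at h3
    have h4 : μ * ‖x - x₀‖ ^ 2 ≤ ‖x - x₀‖ * ‖F x₀‖ := by
      rw [← neg_sub, inner_neg_left] at h2 h3
      rw [inner_sub_right] at h1
      linarith
    have h5 : ‖x - x₀‖ ≤ ‖F x₀‖ / μ := by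
      rw [le_div_iff₀ hμ]
      by_contra hlt
      push Not at hlt
      have : 0 < ‖x - x₀‖ := by
        by_contra h0
        have : ‖x - x₀‖ = 0 := le_antisymm (not_lt.1 h0) (norm_nonneg _)
        rw [this, zero_mul] at hlt
        exact absurd hlt (not_lt.2 (norm_nonneg _))
      nlinarith
    linarith
  refine ⟨x, hxC.1, fun y hy => ?_⟩
  obtain ⟨t, ht0, ht1, ht⟩ : ∃ t : ℝ, 0 < t ∧ t ≤ 1 ∧ ‖x - x₀‖ + t * ‖y - x‖ ≤ R := by
    refine ⟨min 1 ((R - ‖x - x₀‖) / (‖y - x‖ + 1)), ?_, min_le_left _ _, ?_⟩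
    · have : 0 < R - ‖x - x₀‖ := by linarith
      positivity
    · have h1 : min 1 ((R - ‖x - x₀‖) / (‖y - x‖ + 1)) * (‖y - x‖ + 1) ≤ R - ‖x - x₀‖ := by
        rw [← le_div_iff₀ (by positivity)]
        exact min_le_right _ _
      have h2 : 0 ≤ min 1 ((R - ‖x - x₀‖) / (‖y - x‖ + 1)) :=
        le_min zero_le_one (div_nonneg (by linarith) (by positivity))
      nlinarith
  have hz : x + t • (y - x) ∈ C := by
    refine ⟨hconv.add_smul_sub_mem hxC.1 hy ⟨ht0.le, ht1⟩, ?_⟩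
    rw [mem_closedBall_iff_norm, add_sub_right_comm]
    refine (norm_add_le _ _).trans ?_
    rwa [norm_smul, Real.norm_of_nonneg ht0.le]
  have := hx _ hz
  rw [add_sub_cancel_left, inner_smul_left] at this
  exact nonneg_of_mul_nonneg_right this ht0

end VariationalInequality

/-! ### Convex functions -/

section Convex

variable {E : Type*} [NormedAddCommGroup E] [NormedSpace ℝ E]

theorem hasDerivWithinAt_segment {F : Type*} [NormedAddCommGroup F] [NormedSpace ℝ F]
    {s : Set E} (hs : Convex ℝ s) {f : E → F} {f' : E →L[ℝ] F} {x y : E} (hx : x ∈ s) (hy : y ∈ s)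
    {t : ℝ} (hf : HasFDerivWithinAt f f' s (x + t • (y - x))) :
    HasDerivWithinAt (fun r : ℝ => f (x + r • (y - x))) (f' (y - x)) (Set.Icc 0 1) t := by
  have h : HasDerivWithinAt (fun r : ℝ => x + r • (y - x)) (y - x) (Set.Icc 0 1) t := by
    simpa using (((hasDerivAt_id t).smul_const (y - x)).const_add x).hasDerivWithinAt
  exact hf.comp_hasDerivWithinAt t h fun r hr => hs.add_smul_sub_mem hx hy hr

/-- If `f` is minimal over a convex set at `x`, its derivative at `x` is nonnegative in all
directions into the set. -/
theorem fderivWithin_apply_nonneg_of_isMinOn {s : Set E} (hs : Convex ℝ s) {f : E → ℝ}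
    {f' : E →L[ℝ] ℝ} {x y : E} (hx : x ∈ s) (hy : y ∈ s) (hf : HasFDerivWithinAt f f' s x)
    (hmin : ∀ z ∈ s, f x ≤ f z) : 0 ≤ f' (y - x) := by
  have hf0 : HasFDerivWithinAt f f' s (x + (0 : ℝ) • (y - x)) := by simpa using hf
  have h := hasDerivWithinAt_segment hs hx hy hf0
  have h1 := h.mono (Set.Ioo_subset_Icc_self)
  rw [hasDerivWithinAt_iff_tendsto_slope' (by simp), nhdsWithin_Ioo_eq_nhdsGT one_pos] at h1
  refine ge_of_tendsto h1 ?_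
  filter_upwards [Ioo_mem_nhdsGT (one_pos : (0 : ℝ) < 1)] with t ht
  rw [slope_def_field]
  have := hmin _ (hs.add_smul_sub_mem hx hy ⟨ht.1.le, ht.2.le⟩)
  refine div_nonneg ?_ (by linarith [ht.1])
  simpa using this

/-- The tangent inequality for a convex function. -/
theorem convexOn_fderivWithin_apply_le_sub {s : Set E} {f : E → ℝ} (hf : ConvexOn ℝ s f)
    {f' : E →L[ℝ] ℝ} {x y : E} (hx : x ∈ s) (hy : y ∈ s) (hf' : HasFDerivWithinAt f f' s x) :
    f' (y - x) ≤ f y - f x := by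
  have hf0 : HasFDerivWithinAt f f' s (x + (0 : ℝ) • (y - x)) := by simpa using hf'
  have h1 := (hasDerivWithinAt_segment hf.1 hx hy hf0).mono (Set.Ioo_subset_Icc_self)
  rw [hasDerivWithinAt_iff_tendsto_slope' (by simp), nhdsWithin_Ioo_eq_nhdsGT one_pos] at h1
  refine le_of_tendsto h1 ?_
  filter_upwards [Ioo_mem_nhdsGT (one_pos : (0 : ℝ) < 1)] with t ht
  rw [slope_def_field, sub_zero, div_le_iff₀ ht.1]
  have := hf.2 hx hy (sub_nonneg.2 ht.2.le) ht.1.le (by ring)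
  rw [show (1 - t) • x + t • y = x + t • (y - x) by module, smul_eq_mul, smul_eq_mul] at this
  rw [zero_smul, add_zero]
  linarith

/-- The tangent inequality for a function with monotone derivative. -/
theorem fderivWithin_apply_le_sub_of_monotone {s : Set E} (hs : Convex ℝ s) {f : E → ℝ}
    {f' : E → E →L[ℝ] ℝ} (hf : ∀ x ∈ s, HasFDerivWithinAt f (f' x) s x)
    (hmono : ∀ x ∈ s, ∀ y ∈ s, 0 ≤ f' x (x - y) - f' y (x - y)) {x y : E} (hx : x ∈ s)
    (hy : y ∈ s) : f' x (y - x) ≤ f y - f x := by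
  have hmem : ∀ t ∈ Set.Icc (0 : ℝ) 1, x + t • (y - x) ∈ s :=
    fun t ht => hs.add_smul_sub_mem hx hy ht
  have hder : ∀ t ∈ Set.Icc (0 : ℝ) 1, HasDerivWithinAt (fun r : ℝ => f (x + r • (y - x)))
      (f' (x + t • (y - x)) (y - x)) (Set.Icc 0 1) t :=
    fun t ht => hasDerivWithinAt_segment hs hx hy (hf _ (hmem t ht))
  obtain ⟨c, hc, h⟩ := exists_hasDerivAt_eq_slope (fun r : ℝ => f (x + r • (y - x)))
    (fun t => f' (x + t • (y - x)) (y - x)) one_pos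
    (fun t ht => (hder t ht).continuousWithinAt)
    (fun t ht => (hder t (Set.Ioo_subset_Icc_self ht)).hasDerivAt (Icc_mem_nhds ht.1 ht.2))
  have h1 := hmono _ (hmem c (Set.Ioo_subset_Icc_self hc)) x hx
  rw [add_sub_cancel_left, map_smul, map_smul, smul_eq_mul, smul_eq_mul, ← mul_sub] at h1
  have h2 := nonneg_of_mul_nonneg_right h1 hc.1
  simp only [one_smul, zero_smul, add_zero, sub_zero, div_one, add_sub_cancel] at h
  linarith

/-- Lagrange multipliers for convex programs under the Slater condition. -/
theorem exists_lagrange_multipliers {ι : Type*} [Fintype ι] {s : Set E} (hs : Convex ℝ s)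
    {φ : E → ℝ} (hφ : ConvexOn ℝ s φ) {g : ι → E → ℝ} (hg : ∀ k, ConvexOn ℝ s (g k))
    (slater : ∃ x ∈ s, ∀ k, g k x < 0) {x : E}
    (hmin : ∀ y ∈ s, (∀ k, g k y ≤ 0) → φ x ≤ φ y) :
    ∃ c : ι → ℝ, (∀ k, 0 ≤ c k) ∧ ∀ y ∈ s, φ x ≤ φ y + ∑ k, c k * g k y := by
  classical
  -- The pairs strictly above some (g(y), φ(y) - φ(x)). This set is open and convex, and it misses 0
  -- by optimality, so a functional F separates it from 0.
  set A : Set ((ι → ℝ) × ℝ) := ⋃ y ∈ s, {b | ∀ k, g k y < b.1 k} ∩ {b | φ y - φ x < b.2}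
    with hA
  have memA : ∀ b, b ∈ A ↔ ∃ y ∈ s, (∀ k, g k y < b.1 k) ∧ φ y - φ x < b.2 := fun b => by
    simp only [hA, Set.mem_iUnion, exists_prop]
    rfl
  have hAo : IsOpen A := by
    refine isOpen_biUnion fun y _ => IsOpen.inter ?_ ?_
    · simp only [Set.ofPred_forall]
      exact isOpen_iInter_of_finite fun k => isOpen_lt continuous_const (by fun_prop)
    · exact isOpen_lt continuous_const continuous_snd
  have hAc : Convex ℝ A := by
    intro b hb b' hb' t t' ht ht' htt
    rw [memA] at hb hb' ⊢
    obtain ⟨y, hy, h1, h2⟩ := hb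
    obtain ⟨y', hy', h1', h2'⟩ := hb'
    have key : ∀ {a a' d d' : ℝ}, a < d → a' < d' → t * a + t' * a' < t * d + t' * d' := by
      intro a a' d d' h h'
      rcases ht.eq_or_lt with rfl | h0
      · have : t' = 1 := by linarith
        subst this; linarith
      · nlinarith
    refine ⟨t • y + t' • y', hs hy hy' ht ht' htt, fun k => ?_, ?_⟩
    · exact ((hg k).2 hy hy' ht ht' htt).trans_lt (key (h1 k) (h1' k))
    · have := key h2 h2'
      have h3 := hφ.2 hy hy' ht ht' htt
      simp only [smul_eq_mul, Prod.snd_add, Prod.smul_snd] at h3 this ⊢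
      have : t * φ x + t' * φ x = φ x := by rw [← add_mul, htt, one_mul]
      linarith
  have h0 : (0 : (ι → ℝ) × ℝ) ∉ A := by
    rw [memA]
    rintro ⟨y, hy, h1, h2⟩
    have := hmin y hy fun k => (h1 k).le
    simp only [Prod.snd_zero] at h2
    linarith
  obtain ⟨F, hF⟩ := geometric_hahn_banach_point_open hAc hAo h0
  rw [map_zero] at hF
  set c : ι → ℝ := fun k => F (Pi.single k 1, 0) with hc
  set ρ : ℝ := F (0, 1) with hρ
  have hFb : ∀ b, F b = ∑ k, c k * b.1 k + ρ * b.2 := by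
    rintro ⟨w, r⟩
    have : ((w, r) : (ι → ℝ) × ℝ) =
        ∑ k, w k • ((Pi.single k 1, 0) : (ι → ℝ) × ℝ) + r • (0, 1) := by
      ext
      · simp [Prod.fst_sum, Finset.sum_apply, Pi.single_apply]
      · simp [Prod.snd_sum]
    rw [this, map_add, map_sum, map_smul]
    simp only [map_smul, smul_eq_mul, ← this, hc, hρ, mul_comm]
  obtain ⟨x₁, hx₁, hx₁g⟩ := slater
  -- Since A is closed under adding nonnegative vectors, F cannot be negative on any of them.
  have recession : ∀ b : (ι → ℝ) × ℝ, (∀ k, 0 ≤ b.1 k) → 0 ≤ b.2 → 0 ≤ F b := by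
    intro b hb1 hb2
    set a : (ι → ℝ) × ℝ := (0, φ x₁ - φ x + 1)
    have ha : ∀ t : ℝ, 0 ≤ t → 0 < F a + t * F b := by
      intro t ht
      have := hF (a + t • b) ((memA _).2 ⟨x₁, hx₁, fun k => ?_, ?_⟩)
      · simpa using this
      · have := mul_nonneg ht (hb1 k)
        simp only [Prod.fst_add, Prod.smul_fst, Pi.add_apply, Pi.smul_apply, smul_eq_mul, a,
          Pi.zero_apply]
        linarith [hx₁g k]
      · have := mul_nonneg ht hb2
        simp only [Prod.snd_add, Prod.smul_snd, smul_eq_mul, a]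
        linarith
    by_contra hneg
    push Not at hneg
    have h1 := ha 0 le_rfl
    have h2 := ha (F a / -F b) (div_nonneg (by linarith) (by linarith))
    have h3 : F a / -F b * F b = -F a := by
      have := hneg.ne
      field_simp
    linarith
  have hc0 : ∀ k, 0 ≤ c k := fun k =>
    recession _ (fun j => by by_cases h : j = k <;> simp [h]) le_rfl
  have hρ0 : 0 ≤ ρ := recession _ (fun _ => le_rfl) zero_le_one
  -- Slater's point places (0, r) in A for some r, so ρ = 0 would give F the value 0 on A.
  have hρpos : 0 < ρ := by
    refine lt_of_le_of_ne hρ0 fun h => ?_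
    have := hF (0, φ x₁ - φ x + 1) ((memA _).2 ⟨x₁, hx₁, hx₁g, by simp⟩)
    rw [hFb, ← h] at this
    simp at this
  refine ⟨fun k => c k / ρ, fun k => div_nonneg (hc0 k) hρ0, fun y hy => ?_⟩
  -- The point (g(y), φ(y) - φ(x)) lies only on the boundary of A; shift it into A by η in every
  -- coordinate and let η tend to 0.
  have hlim : 0 ≤ ∑ k, c k * g k y + ρ * (φ y - φ x) := by
    refine le_of_forall_pos_lt_add fun δ hδ => ?_
    have hM : 0 < ∑ k, c k + ρ :=
      add_pos_of_nonneg_of_pos (Finset.sum_nonneg fun k _ => hc0 k) hρpos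
    set η := δ / (∑ k, c k + ρ) with hη
    have hηpos : 0 < η := by positivity
    have := hF (fun k => g k y + η, φ y - φ x + η)
      ((memA _).2 ⟨y, hy, fun k => by simpa using hηpos, by simpa using hηpos⟩)
    rw [hFb] at this
    simp only [mul_add, Finset.sum_add_distrib, ← Finset.sum_mul] at this
    have e : (∑ k, c k + ρ) * η = δ := by rw [hη]; field_simp
    linarith
  have : ∑ k, c k / ρ * g k y = (∑ k, c k * g k y) / ρ := by
    rw [Finset.sum_div]
    exact Finset.sum_congr rfl fun k _ => by ring
  rw [this]
  have h2 : 0 ≤ (∑ k, c k * g k y + ρ * (φ y - φ x)) / ρ := div_nonneg hlim hρ0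
  rw [add_div, mul_div_cancel_left₀ _ hρpos.ne'] at h2
  linarith

end Convex

/-! ### Complementarity -/

/-- The variational inequality over a nonnegative orthant is a complementarity problem. -/
theorem forall_nonneg_sum_iff_complementary {ι : Type*} [Fintype ι] {z w : ι → ℝ} :
    ((∀ i, 0 ≤ z i) ∧ ∀ y : ι → ℝ, (∀ i, 0 ≤ y i) → 0 ≤ ∑ i, (y i - z i) * w i) ↔
      ∀ i, 0 ≤ z i ∧ 0 ≤ w i ∧ z i * w i = 0 := by
  classical
  constructor
  · rintro ⟨hz, h⟩ i
    have h1 : 0 ≤ w i := by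
      have := h (Function.update z i (z i + 1)) fun j => by
        by_cases hj : j = i
        · subst hj; simpa using (hz j).trans (by linarith)
        · simpa [hj] using hz j
      rw [Finset.sum_eq_single i (fun j _ hj => by simp [hj]) (by simp)] at this
      simpa using this
    refine ⟨hz i, h1, le_antisymm ?_ (mul_nonneg (hz i) h1)⟩
    have := h (Function.update z i 0) fun j => by
      by_cases hj : j = i
      · subst hj; simp
      · simpa [hj] using hz j
    rw [Finset.sum_eq_single i (fun j _ hj => by simp [hj]) (by simp)] at this
    simp only [Function.update_self, zero_sub, neg_mul] at this
    linarith
  · intro h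
    refine ⟨fun i => (h i).1, fun y hy => Finset.sum_nonneg fun i _ => ?_⟩
    rw [sub_mul, (h i).2.2, sub_zero]
    exact mul_nonneg (hy i) (h i).2.1

theorem mem_lcpSol_neg_iff {N : ℕ} {u z : EuclideanSpace ℝ (Fin N)}
    {M : Matrix (Fin N) (Fin N) ℝ} :
    z ∈ lcpSol (-u) M ↔
      ∀ i, 0 ≤ z i ∧ 0 ≤ (M *ᵥ ⇑z) i - u i ∧ z i * ((M *ᵥ ⇑z) i - u i) = 0 := by
  rw [← forall_nonneg_sum_iff_complementary (w := fun i => (M *ᵥ ⇑z) i - u i)]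
  refine and_congr_right fun _ => ?_
  have key : ∀ y : EuclideanSpace ℝ (Fin N),
      inner ℝ (y - z) (-u + WithLp.toLp 2 (M *ᵥ WithLp.ofLp z)) =
        ∑ i, (y i - z i) * ((M *ᵥ ⇑z) i - u i) := fun y => by
    rw [PiLp.inner_apply]
    refine Finset.sum_congr rfl fun i _ => ?_
    simp only [PiLp.sub_apply, PiLp.add_apply, PiLp.neg_apply, RCLike.inner_apply, conj_trivial]
    ring
  constructor
  · intro h y hy
    have := h (WithLp.toLp 2 y) hy
    rwa [key] at this
  · intro h y hy
    rw [key]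
    exact h y hy

/-! ### The Laplacian of a strongly connected weight-balanced digraph -/

namespace WeightedDigraph

variable {N : ℕ} (G : WeightedDigraph N)

theorem laplacian_mulVec (z : Fin N → ℝ) (i : Fin N) :
    (G.laplacian *ᵥ z) i = ∑ j, G.weight i j * (z i - z j) := by
  rw [laplacian, Matrix.sub_mulVec, Pi.sub_apply, Matrix.mulVec_diagonal, Matrix.mulVec,
    dotProduct, Finset.sum_mul, ← Finset.sum_sub_distrib]
  exact Finset.sum_congr rfl fun j _ => by ring

theorem laplacian_mulVec_add_const (z : Fin N → ℝ) (c : ℝ) :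
    (G.laplacian *ᵥ fun i => z i + c) = G.laplacian *ᵥ z := by
  ext i
  simp only [laplacian_mulVec, add_sub_add_right_eq_sub]

variable {G}

theorem WeightBalanced.sum_laplacian_mulVec (hbal : G.WeightBalanced) (z : Fin N → ℝ) :
    ∑ i, (G.laplacian *ᵥ z) i = 0 := by
  simp only [laplacian_mulVec, mul_sub, Finset.sum_sub_distrib]
  rw [Finset.sum_comm (f := fun i j => G.weight i j * z j)]
  simp only [← Finset.sum_mul]
  rw [sub_eq_zero]
  exact Finset.sum_congr rfl fun i _ => by rw [hbal i]

/-- Balance makes the entries of L applied to z² sum to 0; subtracting half of that sum completes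
the square. -/
theorem WeightBalanced.sum_mul_laplacian_mulVec (hbal : G.WeightBalanced) (z : Fin N → ℝ) :
    ∑ i, z i * (G.laplacian *ᵥ z) i = (∑ i, ∑ j, G.weight i j * (z i - z j) ^ 2) / 2 := by
  have h := hbal.sum_laplacian_mulVec fun i => z i ^ 2
  rw [← sub_zero (∑ i, z i * (G.laplacian *ᵥ z) i), ← zero_div 2, ← h]
  simp only [laplacian_mulVec, Finset.mul_sum, Finset.sum_div, ← Finset.sum_sub_distrib]
  exact Finset.sum_congr rfl fun i _ => Finset.sum_congr rfl fun j _ => by ring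

theorem WeightBalanced.sum_mul_laplacian_mulVec_nonneg (hbal : G.WeightBalanced)
    (z : Fin N → ℝ) : 0 ≤ ∑ i, z i * (G.laplacian *ᵥ z) i := by
  rw [hbal.sum_mul_laplacian_mulVec]
  exact div_nonneg (Finset.sum_nonneg fun i _ => Finset.sum_nonneg fun j _ =>
    mul_nonneg (G.weight_nonneg i j) (sq_nonneg _)) zero_le_two

/-- Every term of the sum of squares vanishes, so z is constant along edges, hence along directed
paths. -/
theorem eq_of_sum_mul_laplacian_mulVec_eq_zero (hconn : G.StronglyConnected)
    (hbal : G.WeightBalanced) {z : Fin N → ℝ} (h : ∑ i, z i * (G.laplacian *ᵥ z) i = 0)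
    (i j : Fin N) : z i = z j := by
  have hnn : ∀ i j, 0 ≤ G.weight i j * (z i - z j) ^ 2 := fun i j =>
    mul_nonneg (G.weight_nonneg i j) (sq_nonneg _)
  rw [hbal.sum_mul_laplacian_mulVec, div_eq_zero_iff, or_iff_left two_ne_zero,
    Finset.sum_eq_zero_iff_of_nonneg fun i _ => Finset.sum_nonneg fun j _ => hnn i j] at h
  have hedge : ∀ a b, G.Edge a b → z a = z b := fun a b hab => by
    have h1 := (Finset.sum_eq_zero_iff_of_nonneg fun j _ => hnn b j).1
      (h b (Finset.mem_univ b)) a (Finset.mem_univ a)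
    have h2 := (mul_eq_zero.1 h1).resolve_left (ne_of_gt hab)
    exact (sub_eq_zero.1 (pow_eq_zero_iff two_ne_zero |>.1 h2)).symm
  induction hconn i j with
  | refl => rfl
  | tail _ hab ih => exact ih.trans (hedge _ _ hab)

/-- The quadratic form of `L + 𝟏𝟏ᵀ` is positive definite. -/
theorem eq_zero_of_sum_mul_laplacian_mulVec_add_sq (hconn : G.StronglyConnected)
    (hbal : G.WeightBalanced) {z : Fin N → ℝ}
    (h : ∑ i, z i * (G.laplacian *ᵥ z) i + (∑ i, z i) ^ 2 = 0) : z = 0 := by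
  have h1 := hbal.sum_mul_laplacian_mulVec_nonneg z
  have h2 := sq_nonneg (∑ i, z i)
  have hc := eq_of_sum_mul_laplacian_mulVec_eq_zero hconn hbal
    (show ∑ i, z i * (G.laplacian *ᵥ z) i = 0 by linarith)
  have hs : ∑ i, z i = 0 := pow_eq_zero_iff two_ne_zero |>.1 (by linarith)
  ext i
  rw [Finset.sum_congr rfl fun j _ => hc j i, Finset.sum_const, Finset.card_univ,
    Fintype.card_fin, nsmul_eq_mul] at hs
  have hN : (N : ℝ) ≠ 0 := by
    have := i.pos
    positivity
  exact (mul_eq_zero.1 hs).resolve_left hN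

/-- Solve (L + 𝟏𝟏ᵀ) z = u. Summing the rows gives N 𝟏ᵀz = 𝟏ᵀu ≤ 0, hence Lz ≥ u; adding a large
constant makes z nonnegative without changing Lz. -/
theorem exists_laplacian_mulVec_ge (hconn : G.StronglyConnected) (hbal : G.WeightBalanced)
    {u : Fin N → ℝ} (hu : ∑ i, u i ≤ 0) :
    ∃ z : Fin N → ℝ, (∀ i, 0 ≤ z i) ∧ ∀ i, u i ≤ (G.laplacian *ᵥ z) i := by
  let T : (Fin N → ℝ) →ₗ[ℝ] (Fin N → ℝ) :=
    G.laplacian.mulVecLin + LinearMap.pi fun _ => ∑ i, LinearMap.proj i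
  have hT : ∀ z i, T z i = (G.laplacian *ᵥ z) i + ∑ j, z j := fun z i => by
    simp [T]
  have hinj : Function.Injective T := by
    rw [← LinearMap.ker_eq_bot, LinearMap.ker_eq_bot']
    intro z hz
    refine eq_zero_of_sum_mul_laplacian_mulVec_add_sq hconn hbal ?_
    have : ∑ i, z i * T z i = 0 := by simp [hz]
    simpa only [hT, mul_add, Finset.sum_add_distrib, ← Finset.sum_mul, ← sq] using this
  obtain ⟨z, hz⟩ := (LinearMap.injective_iff_surjective.1 hinj) u
  have hzi : ∀ i, (G.laplacian *ᵥ z) i + ∑ j, z j = u i := fun i => by rw [← hT, hz]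
  have hsum : N * ∑ j, z j = ∑ i, u i := by
    simp only [← hzi, Finset.sum_add_distrib, hbal.sum_laplacian_mulVec, zero_add,
      Finset.sum_const, Finset.card_univ, Fintype.card_fin, nsmul_eq_mul]
  refine ⟨fun i => z i + ∑ j, |z j|, fun i => ?_, fun i => ?_⟩
  · have := Finset.single_le_sum (f := fun j => |z j|) (fun j _ => abs_nonneg _)
      (Finset.mem_univ i)
    linarith [neg_abs_le (z i)]
  · rw [laplacian_mulVec_add_const, ← hzi i]
    have hN : (0 : ℝ) < N := by exact_mod_cast i.pos
    have : ∑ j, z j ≤ 0 := by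
      by_contra hlt
      push Not at hlt
      linarith [mul_pos hN hlt]
    linarith

/-- The least-sum feasible point of the complementarity problem solves it and touches the boundary
of the orthant. -/
theorem exists_complementary_eq_zero (hconn : G.StronglyConnected) (hbal : G.WeightBalanced)
    (hN : 0 < N) {u : Fin N → ℝ} (hu : ∑ i, u i ≤ 0) :
    ∃ z : Fin N → ℝ, (∀ i, 0 ≤ z i ∧ 0 ≤ (G.laplacian *ᵥ z) i - u i ∧
      z i * ((G.laplacian *ᵥ z) i - u i) = 0) ∧ ∃ i, z i = 0 := by
  obtain ⟨z₀, hz₀, hz₀u⟩ := exists_laplacian_mulVec_ge hconn hbal hu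
  have hcont : ∀ i, Continuous fun z : Fin N → ℝ => (G.laplacian *ᵥ z) i := fun i => by
    simp only [laplacian_mulVec]
    fun_prop
  -- Capping the coordinates gives compactness and discards no candidate whose sum is at most that
  -- of z₀.
  set C : Set (Fin N → ℝ) := Set.Icc 0 (fun _ => ∑ i, z₀ i) ∩
    {z | ∀ i, u i ≤ (G.laplacian *ᵥ z) i} with hC
  have hCc : IsCompact C := by
    refine isCompact_Icc.inter_right ?_
    simp only [Set.ofPred_forall]
    exact isClosed_iInter fun i => isClosed_le continuous_const (hcont i)
  have hz₀C : z₀ ∈ C := ⟨⟨hz₀, fun i => Finset.single_le_sum (fun j _ => hz₀ j)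
    (Finset.mem_univ i)⟩, hz₀u⟩
  obtain ⟨z, hzC, hzmin⟩ := hCc.exists_isMinOn ⟨z₀, hz₀C⟩
    (f := fun z => ∑ i, z i) (Continuous.continuousOn (by fun_prop))
  have hz0 : ∀ i, 0 ≤ z i := hzC.1.1
  have hmin : ∀ y : Fin N → ℝ, (∀ i, 0 ≤ y i) → (∀ i, u i ≤ (G.laplacian *ᵥ y) i) →
      ∑ i, z i ≤ ∑ i, y i := by
    intro y hy hyu
    by_cases hle : ∑ i, y i ≤ ∑ i, z₀ i
    · exact hzmin ⟨⟨hy, fun i => (Finset.single_le_sum (fun j _ => hy j)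
        (Finset.mem_univ i)).trans hle⟩, hyu⟩
    · exact (hzmin hz₀C).trans (not_le.1 hle).le
  refine ⟨z, fun i => ⟨hz0 i, sub_nonneg.2 (hzC.2 i), ?_⟩, ?_⟩
  · by_contra hne
    have hzi : 0 < z i := (hz0 i).lt_of_ne fun h => hne (by rw [← h, zero_mul])
    have hwi : 0 < (G.laplacian *ᵥ z) i - u i :=
      (sub_nonneg.2 (hzC.2 i)).lt_of_ne fun h => hne (by rw [← h, mul_zero])
    set d := ∑ j, G.weight i j with hd
    have hd0 : 0 ≤ d := Finset.sum_nonneg fun j _ => G.weight_nonneg i j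
    -- If z i and the slack of row i were both positive, lowering z i by δ would cost row i at most
    -- d δ and not decrease any other row: a feasible point of smaller sum.
    obtain ⟨δ, hδ, hδz, hδw⟩ : ∃ δ : ℝ, 0 < δ ∧ δ ≤ z i ∧ d * δ ≤ (G.laplacian *ᵥ z) i - u i := by
      refine ⟨min (z i) (((G.laplacian *ᵥ z) i - u i) / (d + 1)), by positivity,
        min_le_left _ _, ?_⟩
      refine (mul_le_mul_of_nonneg_left (min_le_right _ _) hd0).trans ?_
      rw [mul_div_assoc', div_le_iff₀ (by positivity)]
      nlinarith
    have hlt : ∑ j, Function.update z i (z i - δ) j < ∑ j, z j := by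
      refine Finset.sum_lt_sum (fun j _ => ?_) ⟨i, Finset.mem_univ i, by simpa using hδ⟩
      by_cases hj : j = i
      · subst hj; simpa using hδ.le
      · simp [hj]
    refine absurd (hmin (Function.update z i (z i - δ)) (fun j => ?_) fun j => ?_) (not_le.2 hlt)
    · by_cases hj : j = i
      · subst hj; simpa using hδz
      · simpa [hj] using hz0 j
    · by_cases hj : j = i
      · subst hj
        have : (G.laplacian *ᵥ z) j - d * δ ≤
            (G.laplacian *ᵥ Function.update z j (z j - δ)) j := by
          rw [laplacian_mulVec, laplacian_mulVec, hd, Finset.sum_mul, ← Finset.sum_sub_distrib]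
          refine Finset.sum_le_sum fun k _ => ?_
          have hw := mul_nonneg (G.weight_nonneg j k) hδ.le
          by_cases hk : k = j
          · subst hk; simpa using hw
          · simp only [Function.update_self, Function.update_of_ne hk]
            exact le_of_eq (by ring)
        linarith
      · refine (hzC.2 j).trans ?_
        rw [laplacian_mulVec, laplacian_mulVec]
        refine Finset.sum_le_sum fun k _ => ?_
        by_cases hk : k = i
        · subst hk
          simp only [Function.update_self, Function.update_of_ne hj]
          exact mul_le_mul_of_nonneg_left (by linarith) (G.weight_nonneg j k)
        · simp [Function.update_of_ne hj, Function.update_of_ne hk]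
  · by_contra hne
    push Not at hne
    have : Nonempty (Fin N) := ⟨⟨0, hN⟩⟩
    obtain ⟨i₀, hi₀⟩ := Finite.exists_min z
    have hδ : 0 < z i₀ := (hz0 i₀).lt_of_ne' (hne i₀)
    -- If all coordinates were positive, subtracting the smallest would keep Lz and lower the sum.
    have := hmin (fun i => z i + -z i₀) (fun i => by linarith [hi₀ i])
      (fun i => by rw [laplacian_mulVec_add_const]; exact hzC.2 i)
    rw [Finset.sum_add_distrib, Finset.sum_const, Finset.card_univ, Fintype.card_fin,
      nsmul_eq_mul] at this
    have hN' : (0 : ℝ) < N := by exact_mod_cast hN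
    linarith [mul_pos hN' hδ]

/-- The spectral gap of `L + 𝟏𝟏ᵀ`. -/
theorem exists_pos_mul_sum_sq_le (hconn : G.StronglyConnected) (hbal : G.WeightBalanced) :
    ∃ σ : ℝ, 0 < σ ∧ ∀ z : EuclideanSpace ℝ (Fin N),
      σ * ‖z‖ ^ 2 ≤ ∑ i, z i * (G.laplacian *ᵥ ⇑z) i + (∑ i, z i) ^ 2 := by
  set q : EuclideanSpace ℝ (Fin N) → ℝ :=
    fun z => ∑ i, z i * (G.laplacian *ᵥ ⇑z) i + (∑ i, z i) ^ 2 with hq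
  have hcont : Continuous q := by
    simp only [hq, laplacian_mulVec]
    fun_prop
  rcases (Metric.sphere (0 : EuclideanSpace ℝ (Fin N)) 1).eq_empty_or_nonempty with he | hne
  -- An empty unit sphere means that the space is trivial.
  · refine ⟨1, one_pos, fun z => ?_⟩
    have hz : z = 0 := by
      by_contra h
      have hmem : (‖z‖⁻¹ • z) ∈ Metric.sphere (0 : EuclideanSpace ℝ (Fin N)) 1 := by
        simp [norm_smul, inv_mul_cancel₀ (norm_ne_zero_iff.2 h)]
      rw [he] at hmem
      exact hmem
    subst hz
    simp
  · obtain ⟨z₀, hz₀, hmin⟩ := (isCompact_sphere (0 : EuclideanSpace ℝ (Fin N)) 1).exists_isMinOn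
      hne hcont.continuousOn
    have hq0 : 0 ≤ q z₀ := add_nonneg (hbal.sum_mul_laplacian_mulVec_nonneg _) (sq_nonneg _)
    refine ⟨q z₀, hq0.lt_of_ne fun h => ?_, fun z => ?_⟩
    · have h0 := eq_zero_of_sum_mul_laplacian_mulVec_add_sq hconn hbal h.symm
      have : z₀ = 0 := by
        ext i
        exact congrFun h0 i
      rw [this] at hz₀
      simp at hz₀
    · by_cases hz : z = 0
      · subst hz; simp
      have hn := norm_pos_iff.2 hz
      have hmem : (‖z‖⁻¹ • z) ∈ Metric.sphere (0 : EuclideanSpace ℝ (Fin N)) 1 := by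
        simp [norm_smul, inv_mul_cancel₀ hn.ne']
      have h1 : q z₀ ≤ q (‖z‖⁻¹ • z) := hmin hmem
      have h2 : q (‖z‖⁻¹ • z) = ‖z‖⁻¹ ^ 2 * q z := by
        simp only [hq, laplacian_mulVec, PiLp.smul_apply, smul_eq_mul, ← mul_sub, mul_add]
        congr 1
        · simp only [Finset.mul_sum]
          exact Finset.sum_congr rfl fun i _ => Finset.sum_congr rfl fun j _ => by ring
        · rw [← Finset.mul_sum, mul_pow]
      rw [h2, inv_pow, inv_mul_eq_div, le_div_iff₀ (by positivity)] at h1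
      exact h1

/-- Monotonicity of the solution map of the complementarity problem. -/
theorem sum_sub_mul_laplacian_mulVec_le {u u' z z' : Fin N → ℝ}
    (h : ∀ i, 0 ≤ z i ∧ 0 ≤ (G.laplacian *ᵥ z) i - u i ∧
      z i * ((G.laplacian *ᵥ z) i - u i) = 0)
    (h' : ∀ i, 0 ≤ z' i ∧ 0 ≤ (G.laplacian *ᵥ z') i - u' i ∧
      z' i * ((G.laplacian *ᵥ z') i - u' i) = 0) :
    ∑ i, (z i - z' i) * (G.laplacian *ᵥ (z - z')) i ≤ ∑ i, (z i - z' i) * (u i - u' i) := by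
  refine Finset.sum_le_sum fun i _ => ?_
  rw [Matrix.mulVec_sub, Pi.sub_apply]
  have h1 := mul_nonneg (h i).1 (h' i).2.1
  have h2 := mul_nonneg (h' i).1 (h i).2.1
  nlinarith [(h i).2.2, (h' i).2.2]

theorem exists_isLCPConstant (hconn : G.StronglyConnected) (hbal : G.WeightBalanced) :
    ∃ κ : ℝ, 0 < κ ∧ IsLCPConstant G.laplacian κ := by
  rcases Nat.eq_zero_or_pos N with rfl | hN
  · refine ⟨1, one_pos, 0, fun u _ => mem_lcpSol_neg_iff.2 fun i => i.elim0, fun u _ u' _ => ?_⟩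
    simp only [Pi.zero_apply, sub_self, norm_zero, one_mul]
    exact norm_nonneg _
  have hN' : (0 : ℝ) < N := by exact_mod_cast hN
  obtain ⟨σ, hσ, hgap⟩ := exists_pos_mul_sum_sq_le hconn hbal
  have hex : ∀ u : EuclideanSpace ℝ (Fin N), ∃ z : EuclideanSpace ℝ (Fin N),
      u ∈ lcpDomain N → (∀ i, 0 ≤ z i ∧ 0 ≤ (G.laplacian *ᵥ ⇑z) i - u i ∧
        z i * ((G.laplacian *ᵥ ⇑z) i - u i) = 0) ∧ ∃ i, z i = 0 := fun u => by
    by_cases hu : u ∈ lcpDomain N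
    · obtain ⟨z, hz⟩ := exists_complementary_eq_zero hconn hbal hN (u := ⇑u) hu
      exact ⟨WithLp.toLp 2 z, fun _ => hz⟩
    · exact ⟨0, fun h => absurd h hu⟩
  choose S hS using hex
  refine ⟨(1 + √N) ^ 2 / σ, by positivity, S, fun u hu => mem_lcpSol_neg_iff.2 (hS u hu).1,
    fun u hu u' hu' => ?_⟩
  obtain ⟨h, i, hi⟩ := hS u hu
  obtain ⟨h', i', hi'⟩ := hS u' hu'
  set e := S u' - S u with he
  -- Split e into its mean c and its mean-free part b. L does not see c, so the spectral gap
  -- controls only b.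
  set c : ℝ := (∑ j, e j) / N with hc
  set o : EuclideanSpace ℝ (Fin N) := WithLp.toLp 2 fun _ => 1 with ho
  have hon : ‖o‖ = √N := by
    rw [EuclideanSpace.norm_eq]
    simp [ho]
  set b := e - c • o with hb
  have hbi : ∀ j, b j = e j + -c := fun j => by simp [hb, ho, sub_eq_add_neg]
  have hsum : ∑ j, b j = 0 := by
    simp only [hbi, Finset.sum_add_distrib, Finset.sum_const, Finset.card_univ, Fintype.card_fin,
      nsmul_eq_mul, hc]
    field_simp
    ring
  have hcoord : ∀ j, |b j| ≤ ‖b‖ := fun j => by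
    simpa using PiLp.norm_apply_le b j
  -- e is nonnegative where S u vanishes and nonpositive where S u' vanishes; c = e j - b j at these
  -- two indices gives the bounds.
  have hcb : |c| ≤ ‖b‖ := by
    rw [abs_le]
    constructor
    · have h1 : e i' ≤ 0 := by simp [he, hi', (h i').1]
      have h2 : 0 ≤ e i := by simp [he, hi, (h' i).1]
      have h3 := hbi i
      have h4 := (abs_le.1 (hcoord i)).2
      linarith
    · have h1 : e i' ≤ 0 := by simp [he, hi', (h i').1]
      have h3 := hbi i'
      have h4 := (abs_le.1 (hcoord i')).1
      linarith
  have hen : ‖e‖ ≤ (1 + √N) * ‖b‖ := by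
    have : e = b + c • o := by simp [hb]
    rw [this]
    refine (norm_add_le _ _).trans ?_
    rw [norm_smul, hon, Real.norm_eq_abs]
    nlinarith [Real.sqrt_nonneg (N : ℝ)]
  have hLb : G.laplacian *ᵥ ⇑b = G.laplacian *ᵥ ⇑e := by
    rw [← G.laplacian_mulVec_add_const (⇑e) (-c)]
    congr 1
    exact funext hbi
  have hquad : σ * ‖b‖ ^ 2 ≤ ‖e‖ * ‖u' - u‖ := by
    have h1 := hgap b
    rw [hsum, hLb] at h1
    have h2 : ∑ j, b j * (G.laplacian *ᵥ ⇑e) j = ∑ j, e j * (G.laplacian *ᵥ ⇑e) j := by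
      simp only [hbi, add_mul, Finset.sum_add_distrib, ← Finset.mul_sum,
        hbal.sum_laplacian_mulVec, mul_zero, add_zero]
    have h3 := sum_sub_mul_laplacian_mulVec_le h' h
    have h4 : ∑ j, (S u' j - S u j) * (u' j - u j) = inner ℝ e (u' - u) := by
      rw [PiLp.inner_apply]
      refine Finset.sum_congr rfl fun j _ => ?_
      simp [he, mul_comm]
    have h5 := real_inner_le_norm e (u' - u)
    have h6 : ∑ j, e j * (G.laplacian *ᵥ ⇑e) j =
      ∑ j, (S u' j - S u j) * (G.laplacian *ᵥ (⇑(S u') - ⇑(S u))) j := rfl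
    rw [h2, h6] at h1
    linarith
  rw [div_mul_eq_mul_div, le_div_iff₀ hσ]
  by_cases he0 : ‖e‖ = 0
  · rw [he0, zero_mul]; positivity
  have hepos : 0 < ‖e‖ := (norm_nonneg _).lt_of_ne' he0
  have h1 : ‖e‖ ^ 2 ≤ ((1 + √N) * ‖b‖) ^ 2 := by gcongr
  have h2 : σ * ‖e‖ ^ 2 ≤ (1 + √N) ^ 2 * (‖e‖ * ‖u' - u‖) := by
    have h3 := mul_le_mul_of_nonneg_left hquad (sq_nonneg (1 + √(N : ℝ)))
    have h4 := mul_le_mul_of_nonneg_left h1 hσ.le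
    nlinarith
  have h3 : ‖e‖ * (‖e‖ * σ) ≤ ‖e‖ * ((1 + √N) ^ 2 * ‖u' - u‖) := by linarith
  exact le_of_mul_le_mul_left h3 hepos

/-- Every Lipschitz selection of the solution map vanishes at the origin, hence grows at most
linearly. -/
theorem norm_lcp_selection_le {κ : ℝ} (hbal : G.WeightBalanced)
    {S : EuclideanSpace ℝ (Fin N) → EuclideanSpace ℝ (Fin N)}
    (hS : ∀ u ∈ lcpDomain N, S u ∈ lcpSol (-u) G.laplacian)
    (hlip : ∀ u ∈ lcpDomain N, ∀ u' ∈ lcpDomain N, ‖S u' - S u‖ ≤ κ * ‖u' - u‖)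
    {u : EuclideanSpace ℝ (Fin N)} (hu : u ∈ lcpDomain N) : ‖S u‖ ≤ κ * ‖u‖ := by
  set o : EuclideanSpace ℝ (Fin N) := WithLp.toLp 2 fun _ => 1 with ho
  -- At u = 0 every nonnegative constant vector is a solution, so the value 0 is not forced there
  -- directly. At -δ𝟏 it is, and δ → 0 transfers the bound.
  have hmem : ∀ δ : ℝ, 0 < δ → -δ • o ∈ lcpDomain N := fun δ hδ => by
    simp only [lcpDomain, Set.mem_ofPred_eq, ho, PiLp.smul_apply, smul_eq_mul, mul_one,
      Finset.sum_const, Finset.card_univ, Fintype.card_fin, nsmul_eq_mul]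
    have := mul_nonneg (Nat.cast_nonneg (α := ℝ) N) hδ.le
    linarith
  have hzero : ∀ δ : ℝ, 0 < δ → S (-δ • o) = 0 := fun δ hδ => by
    set z := S (-δ • o)
    have h := mem_lcpSol_neg_iff.1 (hS _ (hmem δ hδ))
    have h1 : ∑ i, z i * ((G.laplacian *ᵥ ⇑z) i - (-δ • o) i) = 0 :=
      Finset.sum_eq_zero fun i _ => (h i).2.2
    simp only [ho, PiLp.smul_apply, smul_eq_mul, mul_one, sub_neg_eq_add, mul_add,
      Finset.sum_add_distrib, ← Finset.sum_mul] at h1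
    have h2 := hbal.sum_mul_laplacian_mulVec_nonneg ⇑z
    have h3 : 0 ≤ ∑ i, z i := Finset.sum_nonneg fun i _ => (h i).1
    have h4 : ∑ i, z i = 0 := by
      refine le_antisymm ?_ h3
      by_contra hlt
      push Not at hlt
      linarith [mul_pos hlt hδ]
    ext i
    exact (Finset.sum_eq_zero_iff_of_nonneg fun i _ => (h i).1).1 h4 i (Finset.mem_univ i)
  have hbound : ∀ δ : ℝ, 0 < δ → ‖S u‖ ≤ κ * ‖u - -δ • o‖ := fun δ hδ => by
    have := hlip _ (hmem δ hδ) u hu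
    rwa [hzero δ hδ, sub_zero] at this
  have hlim : Filter.Tendsto (fun δ : ℝ => κ * ‖u - -δ • o‖) (nhdsWithin 0 (Set.Ioi 0))
      (nhds (κ * ‖u‖)) := by
    have : Continuous fun δ : ℝ => κ * ‖u - -δ • o‖ := by fun_prop
    simpa using (this.tendsto 0).mono_left nhdsWithin_le_nhds
  refine ge_of_tendsto hlim ?_
  filter_upwards [self_mem_nhdsWithin] with δ hδ using hbound δ hδ

end WeightedDigraph

/-! ### Stacked multipliers -/

section Dual

variable {N p : ℕ}

/-- The vector of the `k`-th components of all blocks. -/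
def column (w : Dual N p) (k : Fin p) : EuclideanSpace ℝ (Fin N) :=
  WithLp.toLp 2 fun i => w i k

/-- The stacked vector all of whose blocks are `c`. -/
def constDual (N : ℕ) {p : ℕ} (c : Fin p → ℝ) : Dual N p :=
  WithLp.toLp 2 fun _ => WithLp.toLp 2 c

/-- `S` applied to every column. -/
def mapColumns (S : EuclideanSpace ℝ (Fin N) → EuclideanSpace ℝ (Fin N)) (w : Dual N p) :
    Dual N p :=
  WithLp.toLp 2 fun i => WithLp.toLp 2 fun k => S (column w k) i

@[simp] theorem column_apply (w : Dual N p) (k : Fin p) (i : Fin N) : column w k i = w i k := rfl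

theorem column_mapColumns (S : EuclideanSpace ℝ (Fin N) → EuclideanSpace ℝ (Fin N))
    (w : Dual N p) (k : Fin p) : column (mapColumns S w) k = S (column w k) := rfl

theorem column_sub (w w' : Dual N p) (k : Fin p) :
    column (w - w') k = column w k - column w' k := rfl

theorem inner_dual (w w' : Dual N p) : inner ℝ w w' = ∑ i, ∑ k, w i k * w' i k := by
  simp only [PiLp.inner_apply, RCLike.inner_apply, conj_trivial, mul_comm]

theorem norm_sq_eq_sum_column (w : Dual N p) : ‖w‖ ^ 2 = ∑ k, ‖column w k‖ ^ 2 := by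
  simp only [EuclideanSpace.real_norm_sq_eq, PiLp.norm_sq_eq_of_L2, column_apply]
  exact Finset.sum_comm

theorem norm_le_mul_norm_of_column {w w' : Dual N p} {κ : ℝ} (hκ : 0 ≤ κ)
    (h : ∀ k, ‖column w k‖ ≤ κ * ‖column w' k‖) : ‖w‖ ≤ κ * ‖w'‖ := by
  refine le_of_sq_le_sq ?_ (by positivity)
  rw [mul_pow, norm_sq_eq_sum_column, norm_sq_eq_sum_column, Finset.mul_sum]
  refine Finset.sum_le_sum fun k _ => ?_
  rw [← mul_pow]
  gcongr
  exact h k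

/-- `lam` solves the complementarity problems of all columns of `w`. -/
def IsBlockLCPSol (L : Matrix (Fin N) (Fin N) ℝ) (w lam : Dual N p) : Prop :=
  ∀ k, column lam k ∈ lcpSol (-column w k) L

theorem mem_viSol_dualOrthant_iff (z w : Dual N p) :
    z ∈ viSol (dualOrthant N p) (fun _ => w) ↔
      ∀ i k, 0 ≤ z i k ∧ 0 ≤ w i k ∧ z i k * w i k = 0 := by
  have h := forall_nonneg_sum_iff_complementary (z := fun q : Fin N × Fin p => z q.1 q.2)
    (w := fun q => w q.1 q.2)
  simp only [Prod.forall, Fintype.sum_prod_type] at h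
  rw [← h]
  refine and_congr_right fun _ => ?_
  constructor
  · intro hz y hy
    have := hz (WithLp.toLp 2 fun i => WithLp.toLp 2 fun k => y (i, k)) hy
    rwa [inner_dual] at this
  · intro hz y hy
    rw [inner_dual]
    exact hz (fun q => y q.1 q.2) hy

theorem blockMul_apply (L : Matrix (Fin N) (Fin N) ℝ) (lam : Dual N p) (i : Fin N) (k : Fin p) :
    blockMul L lam i k = (L *ᵥ ⇑(column lam k)) i := by
  simp [blockMul, Matrix.mulVec, dotProduct]

theorem convex_dualOrthant : Convex ℝ (dualOrthant N p) := by
  intro x hx y hy a b ha hb _ i k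
  exact add_nonneg (mul_nonneg ha (hx i k)) (mul_nonneg hb (hy i k))

/-- The projection equation says that ε λ is complementary to (L ⊗ I)λ - ε w; the positive factor ε
cancels from ε λ. -/
theorem isProj_dualOrthant_iff (L : Matrix (Fin N) (Fin N) ℝ) {ε : ℝ} (hε : 0 < ε)
    (w lam : Dual N p) :
    IsProj (dualOrthant N p) (ε • lam + ε • w - blockMul L lam) (ε • lam) ↔
      IsBlockLCPSol L (ε • w) lam := by
  have e : ε • lam + ε • w - blockMul L lam = ε • lam - (blockMul L lam - ε • w) := by abel
  rw [e, isProj_sub_iff_mem_viSol convex_dualOrthant (fun _ => blockMul L lam - ε • w),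
    mem_viSol_dualOrthant_iff, forall_comm]
  refine forall_congr' fun k => ?_
  rw [mem_lcpSol_neg_iff]
  refine forall_congr' fun i => ?_
  simp only [PiLp.sub_apply, PiLp.smul_apply, blockMul_apply, column_apply, smul_eq_mul]
  refine and_congr (mul_nonneg_iff_of_pos_left hε) (and_congr Iff.rfl ?_)
  rw [mul_assoc, mul_eq_zero, or_iff_right hε.ne']

theorem IsBlockLCPSol.nonneg {L : Matrix (Fin N) (Fin N) ℝ} {w lam : Dual N p}
    (h : IsBlockLCPSol L w lam) (i : Fin N) (k : Fin p) : 0 ≤ lam i k :=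
  (mem_lcpSol_neg_iff.1 (h k) i).1

theorem IsBlockLCPSol.inner_sub_nonneg {G : WeightedDigraph N} (hbal : G.WeightBalanced)
    {w w' lam lam' : Dual N p} (h : IsBlockLCPSol G.laplacian w lam)
    (h' : IsBlockLCPSol G.laplacian w' lam') : 0 ≤ inner ℝ (lam - lam') (w - w') := by
  rw [inner_dual, Finset.sum_comm]
  refine Finset.sum_nonneg fun k _ => ?_
  exact (hbal.sum_mul_laplacian_mulVec_nonneg _).trans
    (WeightedDigraph.sum_sub_mul_laplacian_mulVec_le (mem_lcpSol_neg_iff.1 (h k))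
      (mem_lcpSol_neg_iff.1 (h' k)))

theorem IsBlockLCPSol.sum_nonpos {G : WeightedDigraph N} (hbal : G.WeightBalanced)
    {w lam : Dual N p} (h : IsBlockLCPSol G.laplacian w lam) (k : Fin p) : ∑ i, w i k ≤ 0 := by
  have h1 : 0 ≤ ∑ i, ((G.laplacian *ᵥ ⇑(column lam k)) i - w i k) :=
    Finset.sum_nonneg fun i _ => (mem_lcpSol_neg_iff.1 (h k) i).2.1
  rw [Finset.sum_sub_distrib, hbal.sum_laplacian_mulVec] at h1
  linarith

/-- Adding a constant `c k` to the `k`-th column preserves solutions if `c k` is complementary to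
the sum of the data. -/
theorem IsBlockLCPSol.add_constDual {G : WeightedDigraph N} (hbal : G.WeightBalanced)
    {w lam : Dual N p} (h : IsBlockLCPSol G.laplacian w lam) {c : Fin p → ℝ} (hc : ∀ k, 0 ≤ c k)
    (hcw : ∀ k, c k * ∑ i, w i k = 0) :
    IsBlockLCPSol G.laplacian w (lam + constDual N c) := by
  intro k
  have hk := mem_lcpSol_neg_iff.1 (h k)
  have hL : G.laplacian *ᵥ ⇑(column (lam + constDual N c) k) =
      G.laplacian *ᵥ ⇑(column lam k) := G.laplacian_mulVec_add_const (⇑(column lam k)) (c k)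
  -- The row slacks sum to minus the sum of the data, so this sum of nonnegative terms is zero and
  -- each term vanishes.
  have hzero : ∑ i, c k * ((G.laplacian *ᵥ ⇑(column lam k)) i - column w k i) = 0 := by
    rw [← Finset.mul_sum, Finset.sum_sub_distrib, hbal.sum_laplacian_mulVec, zero_sub, mul_neg,
      neg_eq_zero]
    exact hcw k
  rw [Finset.sum_eq_zero_iff_of_nonneg fun i _ => mul_nonneg (hc k) (hk i).2.1] at hzero
  rw [mem_lcpSol_neg_iff, hL]
  intro i
  refine ⟨add_nonneg (hk i).1 (hc k), (hk i).2.1, ?_⟩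
  have : column (lam + constDual N c) k i = column lam k i + c k := rfl
  rw [this, add_mul, (hk i).2.2, hzero i (Finset.mem_univ i), add_zero]

end Dual

/-! ### Stacked costs and resources, their derivatives, and the optimal solution -/

namespace Problem

variable {N p : ℕ} (P : Problem N p)

theorem inner_primal (x y : P.Primal) : inner ℝ x y = ∑ i, inner ℝ (x i) (y i) :=
  PiLp.inner_apply x y

theorem norm_primal_le_sum (x : P.Primal) : ‖x‖ ≤ ∑ i, ‖x i‖ := by
  refine le_of_sq_le_sq ?_ (Finset.sum_nonneg fun i _ => norm_nonneg _)
  rw [PiLp.norm_sq_eq_of_L2]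
  exact Finset.sum_sq_le_sq_sum_of_nonneg fun i _ => norm_nonneg _

theorem hasFDerivWithinAt_totalCost {x : P.Primal} (hx : x ∈ P.prodΩ) :
    HasFDerivWithinAt P.totalCost (innerSL ℝ (P.gradCost x)) P.prodΩ x := by
  have h : HasFDerivWithinAt P.totalCost (∑ i, (innerSL ℝ (P.gradf i (x i))).comp
      (PiLp.proj 2 (fun i : Fin N => EuclideanSpace ℝ (Fin (P.n i))) i)) P.prodΩ x :=
    HasFDerivWithinAt.fun_sum fun i _ =>
      HasFDerivWithinAt.comp x (g := P.f i) (f := fun y : P.Primal => y i)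
        (P.hasGradient_f i (x i) (hx i)).hasFDerivWithinAt
        (PiLp.proj 2 (fun i : Fin N => EuclideanSpace ℝ (Fin (P.n i))) i).hasFDerivWithinAt
        (fun y hy => hy i)
  refine h.congr_fderiv (ContinuousLinearMap.ext fun y => ?_)
  simp [inner_primal, gradCost]

theorem hasFDerivWithinAt_inner_u {x : P.Primal} (hx : x ∈ P.prodΩ) (lam : Dual N p) :
    HasFDerivWithinAt (fun y => inner ℝ lam (P.u y)) (innerSL ℝ (P.v x lam)) P.prodΩ x := by
  have h : HasFDerivWithinAt (fun y : P.Primal => ∑ i, inner ℝ (lam i) (P.g i (y i)))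
      (∑ i, ((innerSL ℝ (lam i)).comp (P.jacg i (x i))).comp
      (PiLp.proj 2 (fun i : Fin N => EuclideanSpace ℝ (Fin (P.n i))) i)) P.prodΩ x :=
    HasFDerivWithinAt.fun_sum fun i _ =>
      HasFDerivWithinAt.comp x (g := fun z => inner ℝ (lam i) (P.g i z))
        (f := fun y : P.Primal => y i)
        ((innerSL ℝ (lam i)).hasFDerivAt.comp_hasFDerivWithinAt (x i)
          (P.hasDeriv_g i (x i) (hx i)))
        (PiLp.proj 2 (fun i : Fin N => EuclideanSpace ℝ (Fin (P.n i))) i).hasFDerivWithinAt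
        (fun y hy => hy i)
  have e : (fun y => inner ℝ lam (P.u y)) =
      fun y : P.Primal => ∑ i, inner ℝ (lam i) (P.g i (y i)) :=
    funext fun y => PiLp.inner_apply _ _
  rw [e]
  refine h.congr_fderiv (ContinuousLinearMap.ext fun y => ?_)
  simp [inner_primal, v, ContinuousLinearMap.adjoint_inner_left]

theorem v_add (x : P.Primal) (lam lam' : Dual N p) :
    P.v x (lam + lam') = P.v x lam + P.v x lam' := by
  ext i j
  simp [v]

theorem inner_constDual_u (c : Fin p → ℝ) (x : P.Primal) :
    inner ℝ (constDual N c) (P.u x) = ∑ k, c k * P.totalResource x k := by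
  rw [inner_dual, Finset.sum_comm]
  refine Finset.sum_congr rfl fun k _ => ?_
  simp [constDual, u, totalResource, Finset.mul_sum]

theorem sum_smul_u (ε : ℝ) (x : P.Primal) (k : Fin p) :
    ∑ i, (ε • P.u x) i k = ε * P.totalResource x k := by
  simp [u, totalResource, Finset.mul_sum]

theorem column_smul_u_mem_lcpDomain {ε : ℝ} (hε : 0 < ε) {x : P.Primal} (hx : x ∈ P.feasible)
    (k : Fin p) : column (ε • P.u x) k ∈ lcpDomain N := by
  have h := P.sum_smul_u ε x k
  exact h.trans_le (mul_nonpos_of_nonneg_of_nonpos hε.le (hx.2 k))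

namespace Assumptions

variable {P} {μf κf κg : ℝ}

theorem convex_prodΩ (hP : P.Assumptions μf κf κg) :
    Convex ℝ P.prodΩ := fun _ hx _ hy _ _ ha hb hab i =>
  hP.convex_Ω i (hx i) (hy i) ha hb hab

theorem isClosed_prodΩ (hP : P.Assumptions μf κf κg) : IsClosed P.prodΩ := by
  have : P.prodΩ = ⋂ i, (fun x : P.Primal => x i) ⁻¹' P.Ω i := by
    ext x
    simp [prodΩ]
  rw [this]
  exact isClosed_iInter fun i => (hP.closed_Ω i).preimage (by fun_prop)

theorem norm_u_sub_le (hP : P.Assumptions μf κf κg)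
    {x y : P.Primal} (hx : x ∈ P.prodΩ) (hy : y ∈ P.prodΩ) :
    ‖P.u x - P.u y‖ ≤ κg * ‖x - y‖ := by
  have := hP.κg_pos
  refine le_of_sq_le_sq ?_ (by positivity)
  rw [mul_pow, PiLp.norm_sq_eq_of_L2, PiLp.norm_sq_eq_of_L2, Finset.mul_sum]
  refine Finset.sum_le_sum fun i _ => ?_
  rw [← mul_pow]
  gcongr
  exact hP.lipschitz_g i _ (hx i) _ (hy i)

theorem norm_gradCost_sub_le (hP : P.Assumptions μf κf κg)
    {x y : P.Primal} (hx : x ∈ P.prodΩ) (hy : y ∈ P.prodΩ) :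
    ‖P.gradCost x - P.gradCost y‖ ≤ κf * ‖x - y‖ := by
  have := hP.κf_pos
  refine le_of_sq_le_sq ?_ (by positivity)
  rw [mul_pow, PiLp.norm_sq_eq_of_L2, PiLp.norm_sq_eq_of_L2, Finset.mul_sum]
  refine Finset.sum_le_sum fun i _ => ?_
  rw [← mul_pow]
  gcongr
  exact hP.lipschitz_gradf i _ (hx i) _ (hy i)

theorem inner_gradCost_sub_ge (hP : P.Assumptions μf κf κg)
    {x y : P.Primal} (hx : x ∈ P.prodΩ) (hy : y ∈ P.prodΩ) :
    μf * ‖x - y‖ ^ 2 ≤ inner ℝ (x - y) (P.gradCost x - P.gradCost y) := by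
  rw [PiLp.norm_sq_eq_of_L2, inner_primal, Finset.mul_sum]
  exact Finset.sum_le_sum fun i _ => hP.strongConvex_f i _ (hx i) _ (hy i)

theorem convexOn_inner_u (hP : P.Assumptions μf κf κg)
    {lam : Dual N p} (hlam : ∀ i k, 0 ≤ lam i k) :
    ConvexOn ℝ P.prodΩ fun x => inner ℝ lam (P.u x) := by
  refine ⟨hP.convex_prodΩ, fun x hx y hy a b ha hb hab => ?_⟩
  simp only [inner_dual, smul_eq_mul, Finset.mul_sum, ← Finset.sum_add_distrib]
  refine Finset.sum_le_sum fun i _ => Finset.sum_le_sum fun k _ => ?_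
  have h := mul_le_mul_of_nonneg_left ((hP.convex_g i k).2 (hx i) (hy i) ha hb hab) (hlam i k)
  refine h.trans (le_of_eq ?_)
  simp only [smul_eq_mul, u]
  ring

/-- The tangent inequality for ⟨λ, u(·)⟩, which is convex for λ ≥ 0 and has gradient v(x, λ). -/
theorem inner_sub_v_le (hP : P.Assumptions μf κf κg)
    {x y : P.Primal} (hx : x ∈ P.prodΩ) (hy : y ∈ P.prodΩ) {lam : Dual N p}
    (hlam : ∀ i k, 0 ≤ lam i k) : inner ℝ (y - x) (P.v x lam) ≤ inner ℝ lam (P.u y - P.u x) := by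
  have h := convexOn_fderivWithin_apply_le_sub (hP.convexOn_inner_u hlam) hx hy
    (P.hasFDerivWithinAt_inner_u hx lam)
  rwa [innerSL_apply_apply, real_inner_comm, ← inner_sub_right] at h

theorem convexOn_totalResource (hP : P.Assumptions μf κf κg) (k : Fin p) :
    ConvexOn ℝ P.prodΩ fun x => P.totalResource x k := by
  have h := hP.convexOn_inner_u (lam := constDual N (Pi.single k 1)) fun i j => by
    by_cases hj : j = k <;> simp [constDual, hj]
  refine h.congr fun x _ => ?_
  simp only [inner_constDual_u]
  rw [Finset.sum_eq_single k (fun j _ hj => by simp [hj]) (by simp)]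
  simp

theorem continuousOn_u (hP : P.Assumptions μf κf κg) : ContinuousOn P.u P.prodΩ := by
  refine LipschitzOnWith.continuousOn (K := κg.toNNReal) (LipschitzOnWith.of_dist_le_mul ?_)
  intro x hx y hy
  rw [dist_eq_norm, dist_eq_norm, Real.coe_toNNReal _ hP.κg_pos.le]
  exact hP.norm_u_sub_le hx hy

theorem convex_feasible (hP : P.Assumptions μf κf κg) : Convex ℝ P.feasible := by
  intro x hx y hy a b ha hb hab
  refine ⟨hP.convex_prodΩ hx.1 hy.1 ha hb hab, fun k => ?_⟩
  refine ((hP.convexOn_totalResource k).2 hx.1 hy.1 ha hb hab).trans ?_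
  exact add_nonpos (mul_nonpos_of_nonneg_of_nonpos ha (hx.2 k))
    (mul_nonpos_of_nonneg_of_nonpos hb (hy.2 k))

theorem isClosed_feasible (hP : P.Assumptions μf κf κg) : IsClosed P.feasible := by
  have hcont : ContinuousOn (fun x k => P.totalResource x k) P.prodΩ := by
    have h : ContinuousOn (fun x k => ∑ i, P.u x i k) P.prodΩ := by
      have : Continuous fun (w : Dual N p) k => ∑ i, w i k := by fun_prop
      exact this.comp_continuousOn hP.continuousOn_u
    refine h.congr fun x _ => funext fun k => ?_
    simp [u, totalResource]
  have h := hcont.preimage_isClosed_of_isClosed hP.isClosed_prodΩ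
    (isClosed_Iic (a := (0 : Fin p → ℝ)))
  exact h

theorem exists_slater (hP : P.Assumptions μf κf κg) :
    ∃ x ∈ P.prodΩ, ∀ k, P.totalResource x k < 0 := by
  obtain ⟨x, hx, h⟩ := hP.slater
  exact ⟨x, intrinsicInterior_subset hx, h⟩

theorem nonempty_feasible (hP : P.Assumptions μf κf κg) : P.feasible.Nonempty := by
  obtain ⟨x, hx, h⟩ := hP.exists_slater
  exact ⟨x, hx, fun k => (h k).le⟩

/-- First-order conditions: necessity by moving along feasible segments, sufficiency by the tangent
inequality that monotonicity of the gradient provides. -/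
theorem isOptimal_iff_mem_viSol (hP : P.Assumptions μf κf κg) {x : P.Primal} :
    P.IsOptimal x ↔ x ∈ viSol P.feasible P.gradCost := by
  have hsub : P.feasible ⊆ P.prodΩ := fun y hy => hy.1
  refine and_congr_right fun hx => ⟨fun h y hy => ?_, fun h y hy => ?_⟩
  · have := fderivWithin_apply_nonneg_of_isMinOn hP.convex_feasible hx hy
      ((P.hasFDerivWithinAt_totalCost hx.1).mono hsub) h
    rwa [innerSL_apply_apply, real_inner_comm] at this
  · have h1 := fderivWithin_apply_le_sub_of_monotone hP.convex_prodΩ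
      (fun x hx => P.hasFDerivWithinAt_totalCost hx) (fun x hx y hy => ?_) hx.1 hy.1
    · rw [innerSL_apply_apply, real_inner_comm] at h1
      linarith [h y hy]
    · have h2 := hP.inner_gradCost_sub_ge hx hy
      rw [inner_sub_right, real_inner_comm, real_inner_comm (P.gradCost y)] at h2
      rw [innerSL_apply_apply, innerSL_apply_apply]
      exact (mul_nonneg hP.μf_pos.le (sq_nonneg _)).trans h2

/-- The problem has exactly one optimal solution. -/
theorem existsUnique_isOptimal (hP : P.Assumptions μf κf κg) : ∃! x : P.Primal, P.IsOptimal x := by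
  simp only [hP.isOptimal_iff_mem_viSol]
  obtain ⟨x, hx⟩ := exists_mem_viSol hP.nonempty_feasible hP.isClosed_feasible hP.convex_feasible
    hP.μf_pos (fun x hx y hy => hP.inner_gradCost_sub_ge hx.1 hy.1)
    (fun C hC _ => ⟨κf, fun x hx y hy => hP.norm_gradCost_sub_le (hC hx).1 (hC hy).1⟩)
  refine ⟨x, hx, fun y hy => ?_⟩
  have h1 := hP.inner_gradCost_sub_ge hx.1.1 hy.1.1
  have h2 := hx.2 y hy.1
  have h3 := hy.2 x hx.1
  rw [← neg_sub, inner_neg_left] at h2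
  rw [inner_sub_right] at h1
  have h4 : μf * ‖x - y‖ ^ 2 ≤ 0 := by linarith
  have h5 : ‖x - y‖ ^ 2 ≤ 0 := nonpos_of_mul_nonpos_right h4 hP.μf_pos
  have h6 : ‖x - y‖ = 0 := pow_eq_zero_iff two_ne_zero |>.1 (le_antisymm h5 (sq_nonneg _))
  exact (sub_eq_zero.1 (norm_eq_zero.1 h6)).symm

/-- On a compact set, `v` is Lipschitz up to the size of the multipliers. -/
theorem exists_norm_v_sub_le (hP : P.Assumptions μf κf κg)
    {C : Set P.Primal} (hC : IsCompact C) (hCΩ : C ⊆ P.prodΩ) :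
    ∃ l B : ℝ, 0 ≤ l ∧ 0 ≤ B ∧ ∀ x ∈ C, ∀ y ∈ C, ∀ lam lam' : Dual N p,
      ‖P.v x lam - P.v y lam'‖ ≤ l * ‖x - y‖ * ‖lam‖ + B * ‖lam - lam'‖ := by
  have hloc : ∀ i, ∃ l B : ℝ, 0 ≤ l ∧ 0 ≤ B ∧ ∀ x ∈ C, ∀ y ∈ C,
      ‖P.jacg i (x i) - P.jacg i (y i)‖ ≤ l * ‖x i - y i‖ ∧ ‖P.jacg i (y i)‖ ≤ B := by
    intro i
    have hCi : IsCompact ((fun x : P.Primal => x i) '' C) := hC.image (by fun_prop)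
    have hsub : (fun x : P.Primal => x i) '' C ⊆ P.Ω i := by
      rintro _ ⟨x, hx, rfl⟩
      exact hCΩ hx i
    have hlip := (hP.locallyLipschitz_jacg i).mono hsub
    obtain ⟨B, hB⟩ := hCi.exists_bound_of_continuousOn hlip.continuousOn
    obtain ⟨l, hl⟩ := hlip.exists_lipschitzOnWith_of_compact hCi
    refine ⟨l, max B 0, l.2, le_max_right _ _, fun x hx y hy => ⟨?_, ?_⟩⟩
    · exact hl.norm_sub_le ⟨x, hx, rfl⟩ ⟨y, hy, rfl⟩
    · exact (hB _ ⟨y, hy, rfl⟩).trans (le_max_left _ _)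
  choose l B hl hB h using hloc
  refine ⟨∑ i, l i, ∑ i, B i, Finset.sum_nonneg fun i _ => hl i, Finset.sum_nonneg fun i _ => hB i,
    fun x hx y hy lam lam' => ?_⟩
  refine (P.norm_primal_le_sum _).trans ?_
  simp only [Finset.sum_mul, ← Finset.sum_add_distrib]
  refine Finset.sum_le_sum fun i _ => ?_
  obtain ⟨h1, h2⟩ := h i x hx y hy
  have e : (P.v x lam - P.v y lam') i =
      ContinuousLinearMap.adjoint (P.jacg i (x i) - P.jacg i (y i)) (lam i) +
        ContinuousLinearMap.adjoint (P.jacg i (y i)) ((lam - lam') i) := by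
    simp [v]
  have hxi : ‖x i - y i‖ ≤ ‖x - y‖ := PiLp.norm_apply_le (x - y) i
  have hli : ‖lam i‖ ≤ ‖lam‖ := PiLp.norm_apply_le lam i
  have hli' : ‖(lam - lam') i‖ ≤ ‖lam - lam'‖ := PiLp.norm_apply_le (lam - lam') i
  rw [e]
  refine (norm_add_le _ _).trans (add_le_add ?_ ?_)
  · refine (ContinuousLinearMap.le_opNorm _ _).trans ?_
    rw [LinearIsometryEquiv.norm_map]
    have := hl i
    exact mul_le_mul (h1.trans (by gcongr)) hli (norm_nonneg _) (by positivity)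
  · refine (ContinuousLinearMap.le_opNorm _ _).trans ?_
    rw [LinearIsometryEquiv.norm_map]
    exact mul_le_mul h2 hli' (norm_nonneg _) (hB i)

/-! ### Existence of equilibria and the error estimate -/

theorem isEquilibrium_iff (hP : P.Assumptions μf κf κg)
    (L : Matrix (Fin N) (Fin N) ℝ) {ε : ℝ} (hε : 0 < ε) (x : P.Primal)
    (lam : Dual N p) : P.IsEquilibrium L ε x lam ↔
      x ∈ viSol P.prodΩ (fun y => P.gradCost y + P.v y lam) ∧
        IsBlockLCPSol L (ε • P.u x) lam := by
  rw [IsEquilibrium, sub_sub, isProj_dualOrthant_iff L hε,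
    isProj_sub_iff_mem_viSol hP.convex_prodΩ (fun y => P.gradCost y + P.v y lam)]

variable {G : WeightedDigraph N} {κ ε : ℝ}
  {S : EuclideanSpace ℝ (Fin N) → EuclideanSpace ℝ (Fin N)}

theorem norm_mapColumns_sub_le (hP : P.Assumptions μf κf κg) (hκ : 0 < κ) (hε : 0 < ε)
    (hlip : ∀ u ∈ lcpDomain N, ∀ u' ∈ lcpDomain N, ‖S u' - S u‖ ≤ κ * ‖u' - u‖)
    {x y : P.Primal} (hx : x ∈ P.feasible) (hy : y ∈ P.feasible) :
    ‖mapColumns S (ε • P.u x) - mapColumns S (ε • P.u y)‖ ≤ κ * (ε * (κg * ‖x - y‖)) := by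
  have h : ‖mapColumns S (ε • P.u x) - mapColumns S (ε • P.u y)‖ ≤
      κ * ‖ε • P.u x - ε • P.u y‖ := by
    refine norm_le_mul_norm_of_column hκ.le fun k => ?_
    rw [column_sub, column_sub, column_mapColumns, column_mapColumns]
    exact hlip _ (P.column_smul_u_mem_lcpDomain hε hy k) _
      (P.column_smul_u_mem_lcpDomain hε hx k)
  refine h.trans ?_
  rw [← smul_sub, norm_smul, Real.norm_of_nonneg hε.le]
  gcongr
  exact hP.norm_u_sub_le hx.1 hy.1

/-- The reduced variational inequality, in which the multipliers are eliminated through the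
selection `S`, is solvable. -/
theorem exists_mem_viSol_reduced (hP : P.Assumptions μf κf κg)
    (hbal : G.WeightBalanced) (hκ : 0 < κ) (hε : 0 < ε)
    (hS : ∀ u ∈ lcpDomain N, S u ∈ lcpSol (-u) G.laplacian)
    (hlip : ∀ u ∈ lcpDomain N, ∀ u' ∈ lcpDomain N, ‖S u' - S u‖ ≤ κ * ‖u' - u‖) :
    ∃ x, x ∈ viSol P.feasible
      (fun y => P.gradCost y + P.v y (mapColumns S (ε • P.u y))) := by
  have hsol : ∀ x ∈ P.feasible,
      IsBlockLCPSol G.laplacian (ε • P.u x) (mapColumns S (ε • P.u x)) :=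
    fun x hx k => hS _ (P.column_smul_u_mem_lcpDomain hε hx k)
  refine exists_mem_viSol hP.nonempty_feasible hP.isClosed_feasible hP.convex_feasible hP.μf_pos
    (fun x hx y hy => ?_) fun C hC hCc => ?_
  -- The tangent inequalities at x and y bound the contribution of v below by ⟨λ(x) - λ(y), u(x) -
  -- u(y)⟩, which is nonnegative by LCP monotonicity.
  · have h1 := hP.inner_gradCost_sub_ge hx.1 hy.1
    have h2 := hP.inner_sub_v_le hx.1 hy.1 (hsol x hx).nonneg
    have h3 := hP.inner_sub_v_le hy.1 hx.1 (hsol y hy).nonneg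
    have h4 := (hsol x hx).inner_sub_nonneg hbal (hsol y hy)
    rw [← smul_sub, inner_smul_right] at h4
    have h5 := nonneg_of_mul_nonneg_right h4 hε
    rw [inner_sub_left] at h5
    rw [← neg_sub x y, inner_neg_left, ← neg_sub (P.u x), inner_neg_right] at h2
    rw [add_sub_add_comm, inner_add_right,
      inner_sub_right _ (P.v x (mapColumns S (ε • P.u x)))]
    linarith
  · obtain ⟨l, B, hl, hB, hv⟩ := hP.exists_norm_v_sub_le hCc fun x hx => (hC hx).1
    have hcont : ContinuousOn (fun x => mapColumns S (ε • P.u x)) C := by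
      refine LipschitzOnWith.continuousOn (K := (κ * (ε * κg)).toNNReal)
        (LipschitzOnWith.of_dist_le_mul fun x hx y hy => ?_)
      have := hP.κg_pos
      rw [dist_eq_norm, dist_eq_norm, Real.coe_toNNReal _ (by positivity), mul_assoc, mul_assoc]
      exact hP.norm_mapColumns_sub_le hκ hε hlip (hC hx) (hC hy)
    obtain ⟨M, hM⟩ := hCc.exists_bound_of_continuousOn hcont
    refine ⟨κf + (l * M + B * (κ * (ε * κg))), fun x hx y hy => ?_⟩
    rw [add_sub_add_comm]
    refine (norm_add_le _ _).trans ?_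
    rw [add_mul]
    refine add_le_add (hP.norm_gradCost_sub_le (hC hx).1 (hC hy).1) ?_
    refine (hv x hx y hy _ _).trans ?_
    have h1 := mul_le_mul_of_nonneg_left (hM x hx) (mul_nonneg hl (norm_nonneg (x - y)))
    have h2 := mul_le_mul_of_nonneg_left
      (hP.norm_mapColumns_sub_le hκ hε hlip (hC hx) (hC hy)) hB
    linarith

theorem exists_isEquilibrium (hP : P.Assumptions μf κf κg) (hbal : G.WeightBalanced) (hκ : 0 < κ)
    (hL : IsLCPConstant G.laplacian κ) (hε : 0 < ε) :
    ∃ (x : P.Primal) (lam : Dual N p), P.IsEquilibrium G.laplacian ε x lam := by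
  obtain ⟨S, hS, hlip⟩ := hL
  obtain ⟨x, hx, hvi⟩ := hP.exists_mem_viSol_reduced hbal hκ hε hS hlip
  set lam₀ := mapColumns S (ε • P.u x)
  set F := P.gradCost x + P.v x lam₀
  have hsol : IsBlockLCPSol G.laplacian (ε • P.u x) lam₀ :=
    fun k => hS _ (P.column_smul_u_mem_lcpDomain hε hx k)
  -- With F frozen at x, the reduced variational inequality says that x minimizes the linear
  -- function ⟨F, ·⟩ over the feasible set.
  obtain ⟨c, hc, hmin⟩ := exists_lagrange_multipliers hP.convex_prodΩ (x := x)
    ((innerSL ℝ F).toLinearMap.convexOn hP.convex_prodΩ) hP.convexOn_totalResource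
    hP.exists_slater fun y hy hyg => by
      have := hvi y ⟨hy, hyg⟩
      rw [real_inner_comm, inner_sub_right] at this
      exact sub_nonneg.1 this
  -- Complementary slackness: the multiplier inequality at y = x, where every term is nonpositive.
  have hcompl : ∀ k, c k * P.totalResource x k = 0 := by
    have h1 := hmin x hx.1
    have h2 : ∀ k ∈ Finset.univ, c k * P.totalResource x k ≤ 0 := fun k _ =>
      mul_nonpos_of_nonneg_of_nonpos (hc k) (hx.2 k)
    have h3 : ∑ k, c k * P.totalResource x k = 0 :=
      le_antisymm (Finset.sum_nonpos h2) (by linarith)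
    exact fun k => (Finset.sum_eq_zero_iff_of_nonpos h2).1 h3 k (Finset.mem_univ k)
  refine ⟨x, lam₀ + constDual N c, (hP.isEquilibrium_iff _ hε _ _).2 ⟨⟨hx.1, fun y hy => ?_⟩,
    hsol.add_constDual hbal hc fun k => ?_⟩⟩
  -- x minimizes ⟨F, ·⟩ + ⟨𝟏 ⊗ c, u(·)⟩ over all of Ω, and the gradient there is F + v(x, 𝟏 ⊗ c).
  · have hder := (innerSL ℝ F).hasFDerivWithinAt.add
      (P.hasFDerivWithinAt_inner_u hx.1 (constDual N c))
    have h := fderivWithin_apply_nonneg_of_isMinOn hP.convex_prodΩ hx.1 hy hder fun z hz => by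
      have := hmin z hz
      simp only [Pi.add_apply, inner_constDual_u, hcompl, Finset.sum_const_zero, add_zero]
      exact this
    beta_reduce
    rw [P.v_add, ← add_assoc, inner_add_right, real_inner_comm, real_inner_comm (P.v x _)]
    exact h
  · rw [P.sum_smul_u, mul_left_comm, hcompl, mul_zero]

theorem norm_sub_le_of_isEquilibrium (hP : P.Assumptions μf κf κg)
    (hbal : G.WeightBalanced) (hκ : 0 < κ)
    (hL : IsLCPConstant G.laplacian κ) (hε : 0 < ε) {xs x : P.Primal} (hxs : P.IsOptimal xs)
    {lam : Dual N p} (hx : P.IsEquilibrium G.laplacian ε x lam) :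
    μf * ‖x - xs‖ ≤ κg * κ * ‖P.u xs‖ * ε := by
  obtain ⟨S, hS, hlip⟩ := hL
  obtain ⟨⟨hxΩ, hvi⟩, hlam⟩ := (hP.isEquilibrium_iff _ hε _ _).1 hx
  have hxf : x ∈ P.feasible := ⟨hxΩ, fun k => by
    have := hlam.sum_nonpos hbal k
    rw [P.sum_smul_u] at this
    exact nonpos_of_mul_nonpos_right this hε⟩
  obtain ⟨hxsf, hopt⟩ := hP.isOptimal_iff_mem_viSol.1 hxs
  set s := mapColumns S (ε • P.u xs)
  have hs : IsBlockLCPSol G.laplacian (ε • P.u xs) s :=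
    fun k => hS _ (P.column_smul_u_mem_lcpDomain hε hxsf k)
  have hsn : ‖s‖ ≤ κ * (ε * ‖P.u xs‖) := by
    rw [← Real.norm_of_nonneg hε.le, ← norm_smul]
    exact norm_le_mul_norm_of_column hκ.le fun k =>
      WeightedDigraph.norm_lcp_selection_le hbal hS hlip
        (P.column_smul_u_mem_lcpDomain hε hxsf k)
  -- The tangent inequality turns the v-term into ⟨λ, u(x*) - u(x)⟩, and LCP monotonicity replaces
  -- the uncontrolled λ by s.
  have hquad : μf * ‖x - xs‖ ^ 2 ≤ inner ℝ s (P.u xs - P.u x) := by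
    have h1 := hP.inner_gradCost_sub_ge hxΩ hxsf.1
    have h2 := hvi xs hxsf.1
    have h3 := hopt x hxf
    have h4 := hP.inner_sub_v_le hxΩ hxsf.1 hlam.nonneg
    have h5 := hs.inner_sub_nonneg hbal hlam
    rw [← smul_sub, inner_smul_right] at h5
    have h6 := nonneg_of_mul_nonneg_right h5 hε
    rw [inner_sub_left] at h6
    rw [inner_add_right, ← neg_sub x xs, inner_neg_left] at h2
    rw [inner_sub_right] at h1
    rw [← neg_sub x xs] at h4
    linarith
  have h1 : μf * ‖x - xs‖ ^ 2 ≤ κ * (ε * ‖P.u xs‖) * (κg * ‖x - xs‖) := by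
    refine hquad.trans ((real_inner_le_norm _ _).trans ?_)
    have h2 := hP.norm_u_sub_le hxsf.1 hxΩ
    rw [norm_sub_rev xs x] at h2
    exact mul_le_mul hsn h2 (norm_nonneg _) (by positivity)
  have := hP.κg_pos
  rcases (norm_nonneg (x - xs)).eq_or_lt with h0 | h0
  · rw [← h0, mul_zero]
    positivity
  · refine le_of_mul_le_mul_right ?_ h0
    linarith

end Assumptions

end Problem

end ResourceAllocation

end

theorem theorem2 {N p : ℕ} (G : ResourceAllocation.WeightedDigraph N)
    (hconn : G.StronglyConnected) (hbal : G.WeightBalanced)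
    (P : ResourceAllocation.Problem N p) (μf κf κg : ℝ) (hP : P.Assumptions μf κf κg) :
    (∃ κL : ℝ, 0 < κL ∧ ResourceAllocation.IsLCPConstant G.laplacian κL) ∧
    (∃! xs : P.Primal, P.IsOptimal xs) ∧
    ∀ κL : ℝ, 0 < κL → ResourceAllocation.IsLCPConstant G.laplacian κL →
      ∀ xs : P.Primal, P.IsOptimal xs →
        ∀ ε : ℝ, 0 < ε → ε < μf / (2 * κg ^ 2 * κL) →
          (∃ (x : P.Primal) (lam : ResourceAllocation.Dual N p),
            P.IsEquilibrium G.laplacian ε x lam) ∧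
          ∀ (x : P.Primal) (lam : ResourceAllocation.Dual N p),
            P.IsEquilibrium G.laplacian ε x lam →
              ‖x - xs‖ ≤ (2 * κg * κL * ‖P.u xs‖ / μf) * ε := by
  refine ⟨ResourceAllocation.WeightedDigraph.exists_isLCPConstant hconn hbal,
    hP.existsUnique_isOptimal, fun κL hκ hL xs hxs ε hε _ =>
      ⟨hP.exists_isEquilibrium hbal hκ hL hε, fun x lam hx => ?_⟩⟩
  have h := hP.norm_sub_le_of_isEquilibrium hbal hκ hL hε hxs hx
  have hg := hP.κg_pos
  -- The estimate just obtained has constant K/2; nonnegativity absorbs the factor 2.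
  have h0 : 0 ≤ κg * κL * ‖P.u xs‖ * ε := by positivity
  rw [div_mul_eq_mul_div, le_div_iff₀ hP.μf_pos]
  linarith
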